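/- For $N\ge 0$ identify $a=(a_1,\dots,a_N)\in\mathbf{R}^N$ with the monic polynomial $P(x)=x^N+a_1x^{N-1}+\cdots+a_N$. Let $\Omega_N\subset\mathbf{R}^N$ be the set of those $P$ all of whose complex roots have absolute value at most $1$, let $dV$ be Lebesgue measure on $\mathbf{R}^N$, and let $D_N=\int_{\Omega_N}dV$ be the volume of $\Omega_N$. Let $Z(P)$ be the number of real roots of $P$ (counted with multiplicity), and let $$r_N=\frac{1}{D_N}\int_{\Omega_N}Z(P)\,dV$$ be the expected number of real roots of a uniformly random polynomial in $\Omega_N$. **Theorem.** Assume the following conjectural formulas hold for every integer $m\ge 0$ and every $T\in[-1,1]$: for $N=2m$, $$\frac{1}{D_N}\int_{\Omega_N}|P(T)|\,dV=\frac{1}{2^{2m}\binom{2m}{m}}\left(\sum_{k=0}^{m}\frac{2m-2k+1}{2m+1}\binom{2m-2k}{m-k}\binom{2k}{k}T^{2k}\right)\left(\sum_{k=0}^{m}\binom{2m-2k}{m-k}\binom{2k}{k}T^{2k}\right),$$ and for $N=2m+1$, $$\frac{1}{D_N}\int_{\Omega_N}|P(T)|\,dV=\frac{1}{2^{2m+2}\binom{2m}{m}}\left(\sum_{k=0}^{m}\frac{2m-2k+1}{2m+1}\binom{2m-2k}{m-k}\binom{2k}{k}T^{2k}\right)\left(\sum_{k=0}^{m+1}\binom{2m+2-2k}{m+1-k}\binom{2k}{k}T^{2k}\right).$$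 Then, as $N\to\infty$, $$r_N\sim\frac{1}{\pi}\log N .$$ -/

import Mathlib

open MeasureTheory Filter Asymptotics

namespace RandomPoly

/-- The monic real polynomial `x ^ N + ∑ i, a i * x ^ i` of degree `N` whose lower
coefficients are the coordinates of `a ∈ ℝ ^ N`. -/
noncomputable def monicPoly (N : ℕ) (a : Fin N → ℝ) : Polynomial ℝ :=
  Polynomial.X ^ N + ∑ i : Fin N, Polynomial.C (a i) * Polynomial.X ^ (i : ℕ)

/-- The region `Ω_N ⊆ ℝ ^ N` of (coefficient vectors of) monic real polynomials of degree `N`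
all of whose complex roots have absolute value at most `1`. -/
def Omega (N : ℕ) : Set (Fin N → ℝ) :=
  {a | ∀ z : ℂ, Polynomial.aeval z (monicPoly N a) = 0 → ‖z‖ ≤ 1}

/-- `D_N`, the volume of `Ω_N` for Lebesgue measure in the coefficients. -/
noncomputable def D (N : ℕ) : ℝ := (volume : Measure (Fin N → ℝ)).real (Omega N)

/-- The number of real roots of the polynomial, counted with multiplicity. -/
noncomputable def numRealRoots (N : ℕ) (a : Fin N → ℝ) : ℕ :=
  Multiset.card (monicPoly N a).roots

/-- `r_N`, the expected number of real roots of a uniformly random polynomial in `Ω_N`. -/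
noncomputable def expectedRealRoots (N : ℕ) : ℝ :=
  1 / D N * ∫ a in Omega N, (numRealRoots N a : ℝ)

/-- The mean of `|P(T)|` over `P ∈ Ω_N`. -/
noncomputable def meanAbs (N : ℕ) (T : ℝ) : ℝ :=
  1 / D N * ∫ a in Omega N, |(monicPoly N a).eval T|

/-- The sum `∑_{k=0}^m (2m-2k+1)/(2m+1) * binom(2m-2k, m-k) * binom(2k, k) * T^(2k)`. -/
noncomputable def weightedSum (m : ℕ) (T : ℝ) : ℝ :=
  ∑ k ∈ Finset.range (m + 1), (2 * (m : ℝ) - 2 * (k : ℝ) + 1) / (2 * (m : ℝ) + 1)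
    * (Nat.choose (2 * m - 2 * k) (m - k) : ℝ) * (Nat.choose (2 * k) k : ℝ) * T ^ (2 * k)

/-- The sum `∑_{k=0}^m binom(2m-2k, m-k) * binom(2k, k) * T^(2k)`. -/
noncomputable def plainSum (m : ℕ) (T : ℝ) : ℝ :=
  ∑ k ∈ Finset.range (m + 1),
    (Nat.choose (2 * m - 2 * k) (m - k) : ℝ) * (Nat.choose (2 * k) k : ℝ) * T ^ (2 * k)

/-- The conjectural formula for the mean of `|P(T)|` over `Ω_N`, for `T ∈ [-1, 1]`, with `N = 2m`
in the first part and `N = 2m + 1` in the second. -/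
def AbsoluteConjecture : Prop :=
  (∀ m : ℕ, ∀ T ∈ Set.Icc (-1 : ℝ) 1,
    meanAbs (2 * m) T =
      1 / (2 ^ (2 * m) * (Nat.choose (2 * m) m : ℝ)) * weightedSum m T * plainSum m T) ∧
  (∀ m : ℕ, ∀ T ∈ Set.Icc (-1 : ℝ) 1,
    meanAbs (2 * m + 1) T =
      1 / (2 ^ (2 * m + 2) * (Nat.choose (2 * m) m : ℝ)) * weightedSum m T * plainSum (m + 1) T)

end RandomPoly

namespace RandomPoly

/-! The expectation comes from a Kac-type formula. A pair (P, T) with T a real root of P of degree n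
+ 1 is the same as P = (x - T)Q, and P lies in Ω_{n+1} exactly when T ∈ [-1, 1] and Q ∈ Ω_n. The map
taking T and the nonconstant coefficients of P to P has Jacobian -P'(T) = -Q(T). The area formula
therefore gives ∫_{Ω_{n+1}} Z = ∫_{-1}^1 ∫_{Ω_n} |Q(T)| dQ dT (`lintegral_numRealRoots_eq`), and
r_{n+1} is D_n / D_{n+1} times the integral over T of the conjectured mean.

The ratio of volumes is unconditional. For |k| < 1 the Schur–Cohn step P ↦ xP + kP*, with P* the
reciprocal polynomial, identifies Ω_n with the slice of Ω_{n+1} at constant coefficient k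
(`levinson_mem_Omega_iff`). On coefficients it is the linear map 1 + kJ, J the reversal, and
integrating its determinant over k gives `D_succ`.

Write u_k = binom(2k, k) / 4^k. With m = ⌊n/2⌋ and M = ⌈n/2⌉ all prefactors cancel, leaving r_{n+1}
= ∑_{k,j} (2(m-k)+1) u_{m-k} u_{M-j} · u_k u_j / (2(k+j)+1). By Wallis, (2(m-k)+1) u_{m-k} u_{M-j}
is close to 2/π when k and j are small compared with n. Since ∑_{k+j=l} u_k u_j = 1, the remaining
sum behaves like ∑ 1/(2l+1) ~ (1/2) log n, whence (1/π) log n. Cutting at K = ⌊n / √(log n)⌋ makes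
every error o(log n). -/

/-! ### Coefficients, complex roots and compactness of Ω_N -/

open Polynomial in
theorem coeff_monicPoly (N : ℕ) (a : Fin N → ℝ) (j : ℕ) :
    (monicPoly N a).coeff j = if h : j < N then a ⟨j, h⟩ else if j = N then 1 else 0 := by
  simp only [monicPoly, coeff_add, coeff_X_pow, finsetSum_coeff, coeff_C_mul]
  by_cases h1 : j < N
  · rw [dif_pos h1, if_neg (by omega), zero_add, Finset.sum_eq_single ⟨j, h1⟩]
    · simp
    · intro b _ hb
      rw [if_neg (fun h => hb (Fin.ext h.symm)), mul_zero]
    · simp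
  · rw [dif_neg h1, Finset.sum_eq_zero, add_zero]
    intro i _
    rw [if_neg (by have := i.2; omega), mul_zero]

theorem natDegree_monicPoly (N : ℕ) (a : Fin N → ℝ) : (monicPoly N a).natDegree = N := by
  apply le_antisymm
  · rw [Polynomial.natDegree_le_iff_coeff_eq_zero]
    intro j hj
    rw [coeff_monicPoly, dif_neg (by omega), if_neg (by omega)]
  · apply Polynomial.le_natDegree_of_ne_zero
    simp [coeff_monicPoly]

theorem monic_monicPoly (N : ℕ) (a : Fin N → ℝ) : (monicPoly N a).Monic := by
  rw [Polynomial.Monic, Polynomial.leadingCoeff, natDegree_monicPoly]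
  simp [coeff_monicPoly]

theorem eq_monicPoly_of_monic {N : ℕ} {P : Polynomial ℝ} (hP : P.Monic) (hN : P.natDegree = N) :
    monicPoly N (fun i => P.coeff i) = P := by
  ext j
  rw [coeff_monicPoly]
  split_ifs with h1 h2
  · rfl
  · rw [h2, ← hN]; exact hP.symm
  · rw [Polynomial.coeff_eq_zero_of_natDegree_lt (by omega)]

theorem aeval_monicPoly (N : ℕ) (a : Fin N → ℝ) (z : ℂ) :
    Polynomial.aeval z (monicPoly N a) = z ^ N + ∑ i, (a i : ℂ) * z ^ (i : ℕ) := by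
  simp [monicPoly]

theorem eval_monicPoly (N : ℕ) (a : Fin N → ℝ) (x : ℝ) :
    (monicPoly N a).eval x = x ^ N + ∑ i, a i * x ^ (i : ℕ) := by
  simp [monicPoly, Polynomial.eval_finsetSum]

/-- The complex roots of the polynomial, counted with multiplicity. -/
noncomputable def complexRoots (N : ℕ) (a : Fin N → ℝ) : Multiset ℂ :=
  ((monicPoly N a).map (algebraMap ℝ ℂ)).roots

theorem card_complexRoots (N : ℕ) (a : Fin N → ℝ) : Multiset.card (complexRoots N a) = N := by
  rw [complexRoots, ← (IsAlgClosed.splits _).natDegree_eq_card_roots, Polynomial.natDegree_map,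
    natDegree_monicPoly]

theorem aeval_eq_prod_complexRoots (N : ℕ) (a : Fin N → ℝ) (z : ℂ) :
    Polynomial.aeval z (monicPoly N a) = ((complexRoots N a).map (fun r => z - r)).prod := by
  have h := (IsAlgClosed.splits ((monicPoly N a).map (algebraMap ℝ ℂ))).eq_prod_roots_of_monic
    ((monic_monicPoly N a).map _)
  have h2 := congrArg (Polynomial.eval z) h
  rw [Polynomial.eval_map_algebraMap] at h2
  rw [h2, Polynomial.eval_multiset_prod, Multiset.map_map]
  simp [complexRoots]

theorem norm_le_one_of_mem_complexRoots {N : ℕ} {a : Fin N → ℝ} (ha : a ∈ Omega N) {r : ℂ}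
    (hr : r ∈ complexRoots N a) : ‖r‖ ≤ 1 := by
  apply ha
  rw [complexRoots, Polynomial.mem_roots', Polynomial.IsRoot, Polynomial.eval_map_algebraMap] at hr
  exact hr.2

theorem norm_multiset_prod (s : Multiset ℂ) (f : ℂ → ℂ) :
    ‖(s.map f).prod‖ = (s.map (fun r => ‖f r‖)).prod := by
  rw [← normHom_apply, map_multiset_prod, Multiset.map_map]; rfl

/-- Every root is at distance at least ‖z‖ - 1 from z. This turns nonvanishing outside the disc, an
open condition, into a closed one, which is how Ω_N is seen to be closed. -/
theorem pow_le_norm_aeval {N : ℕ} {a : Fin N → ℝ} (ha : a ∈ Omega N) {z : ℂ} (hz : 1 ≤ ‖z‖) :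
    (‖z‖ - 1) ^ N ≤ ‖Polynomial.aeval z (monicPoly N a)‖ := by
  rw [aeval_eq_prod_complexRoots, norm_multiset_prod]
  have : (‖z‖ - 1) ^ N = ((complexRoots N a).map (fun _ => ‖z‖ - 1)).prod := by
    simp [card_complexRoots]
  rw [this]
  apply Multiset.prod_map_le_prod_map₀
  · intros; linarith
  · intro r hr
    have h1 := norm_le_one_of_mem_complexRoots ha hr
    have h2 := norm_sub_norm_le z r
    linarith

theorem isClosed_Omega (N : ℕ) : IsClosed (Omega N) := by
  have : Omega N = ⋂ z : {z : ℂ // 1 ≤ ‖z‖},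
      {a | (‖z.1‖ - 1) ^ N ≤ ‖Polynomial.aeval z.1 (monicPoly N a)‖} := by
    ext a
    simp only [Set.mem_iInter, Set.mem_ofPred_eq]
    constructor
    · rintro ha ⟨z, hz⟩
      exact pow_le_norm_aeval ha hz
    · intro h z hz
      by_contra! hlt
      have := h ⟨z, hlt.le⟩
      simp only [hz, norm_zero] at this
      have : 0 < (‖z‖ - 1) ^ N := pow_pos (by linarith) _
      linarith
  rw [this]
  refine isClosed_iInter fun z => isClosed_le continuous_const ?_
  simp only [aeval_monicPoly]
  fun_prop

theorem isBounded_Omega (N : ℕ) : Bornology.IsBounded (Omega N) := by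
  rw [isBounded_iff_forall_norm_le]
  refine ⟨max 1 1 ^ N * N.choose (N / 2), fun a ha => ?_⟩
  rw [pi_norm_le_iff_of_nonneg (by positivity)]
  intro i
  have := Polynomial.coeff_bdd_of_roots_le (algebraMap ℝ ℂ) (monic_monicPoly N a)
    (IsAlgClosed.splits _) (natDegree_monicPoly N a).le
    (fun z hz => norm_le_one_of_mem_complexRoots ha hz) i
  simpa [coeff_monicPoly] using this

theorem isCompact_Omega (N : ℕ) : IsCompact (Omega N) :=
  Metric.isCompact_of_isClosed_isBounded (isClosed_Omega N) (isBounded_Omega N)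

theorem measurableSet_Omega (N : ℕ) : MeasurableSet (Omega N) := (isClosed_Omega N).measurableSet

theorem abs_constCoeff_le {n : ℕ} {a : Fin (n + 1) → ℝ} (ha : a ∈ Omega (n + 1)) : |a 0| ≤ 1 := by
  have := Polynomial.coeff_le_of_roots_le 0 (monic_monicPoly (n + 1) a)
    (IsAlgClosed.splits ((monicPoly (n + 1) a).map (algebraMap ℝ ℂ)))
    (fun z hz => norm_le_one_of_mem_complexRoots ha hz)
  simpa [coeff_monicPoly] using this

/-! ### The reciprocal polynomial and the Schur–Cohn step -/

theorem norm_one_sub_conj_mul_le {z r : ℂ} (hz : 1 ≤ ‖z‖) (hr : ‖r‖ ≤ 1) :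
    ‖1 - (starRingEnd ℂ) z * r‖ ≤ ‖z - r‖ := by
  rw [← sq_le_sq₀ (norm_nonneg _) (norm_nonneg _)]
  have e : ‖z - r‖ ^ 2 - ‖1 - (starRingEnd ℂ) z * r‖ ^ 2 = (‖z‖ ^ 2 - 1) * (1 - ‖r‖ ^ 2) := by
    simp only [← Complex.normSq_eq_norm_sq, Complex.normSq_apply, Complex.sub_re, Complex.sub_im,
      Complex.mul_re, Complex.mul_im, Complex.conj_re, Complex.conj_im, Complex.one_re,
      Complex.one_im]
    ring
  have h1 : 0 ≤ ‖z‖ ^ 2 - 1 := by nlinarith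
  have h2 : 0 ≤ 1 - ‖r‖ ^ 2 := by nlinarith [norm_nonneg r]
  nlinarith [mul_nonneg h1 h2]

/-- The reciprocal polynomial is dominated by the polynomial outside the open unit disc. -/
theorem norm_reciprocal_le {N : ℕ} {a : Fin N → ℝ} (ha : a ∈ Omega N) {z : ℂ} (hz : 1 ≤ ‖z‖) :
    ‖z ^ N * Polynomial.aeval z⁻¹ (monicPoly N a)‖ ≤ ‖Polynomial.aeval z (monicPoly N a)‖ := by
  have hz0 : z ≠ 0 := by rintro rfl; simp at hz; linarith
  -- The coefficients are real, so values at conjugate points have equal norm; with the conjugate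
  -- inside, each root contributes exactly the Blaschke factor bounded above.
  have e1 : ‖Polynomial.aeval z⁻¹ (monicPoly N a)‖ =
      ‖Polynomial.aeval ((starRingEnd ℂ) z)⁻¹ (monicPoly N a)‖ := by
    rw [← Complex.norm_conj, aeval_monicPoly, aeval_monicPoly]
    simp
  rw [norm_mul, e1, aeval_eq_prod_complexRoots, aeval_eq_prod_complexRoots, norm_multiset_prod,
    norm_multiset_prod]
  have e2 : ‖z ^ N‖ = ((complexRoots N a).map (fun _ => ‖z‖)).prod := by
    simp [card_complexRoots]
  rw [e2, ← Multiset.prod_map_mul]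
  apply Multiset.prod_map_le_prod_map₀
  · intros; positivity
  · intro r hr
    refine le_trans (le_of_eq ?_)
      (norm_one_sub_conj_mul_le hz (norm_le_one_of_mem_complexRoots ha hr))
    have hc : (starRingEnd ℂ) z ≠ 0 := by simpa using hz0
    rw [← Complex.norm_conj z, ← norm_mul, mul_sub, mul_inv_cancel₀ hc]

/-- The coefficients of `x P(x) + k P*(x)`, where `P*` is the reciprocal polynomial of `P`. -/
def levinson (n : ℕ) (k : ℝ) (a : Fin n → ℝ) : Fin (n + 1) → ℝ :=
  Fin.cons k (fun i => a i + k * a i.rev)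

theorem aeval_levinson (n : ℕ) (k : ℝ) (a : Fin n → ℝ) {z : ℂ} (hz : z ≠ 0) :
    Polynomial.aeval z (monicPoly (n + 1) (levinson n k a)) =
      z * Polynomial.aeval z (monicPoly n a) +
        k * (z ^ n * Polynomial.aeval z⁻¹ (monicPoly n a)) := by
  have e : z ^ n * ∑ i, (a i : ℂ) * z⁻¹ ^ (i : ℕ) = ∑ i : Fin n, (a i.rev : ℂ) * z ^ ((i : ℕ) + 1) := by
    rw [Finset.mul_sum, ← Equiv.sum_comp Fin.revPerm]
    refine Finset.sum_congr rfl fun i _ => ?_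
    have h : z ^ n = z ^ (n - (i + 1) : ℕ) * z ^ ((i : ℕ) + 1) := by
      rw [← pow_add]; congr 1; have := i.2; omega
    simp only [Fin.revPerm_apply, Fin.val_rev]
    rw [h, inv_pow]
    field_simp
  simp only [aeval_monicPoly, levinson, Fin.sum_univ_succ, Fin.cons_zero, Fin.cons_succ,
    Fin.val_zero, pow_zero, mul_one, Fin.val_succ, mul_add, inv_pow]
  have hp : z ^ n * (z ^ n)⁻¹ = 1 := mul_inv_cancel₀ (pow_ne_zero _ hz)
  simp only [← inv_pow, e]
  push_cast
  simp only [add_mul, Finset.sum_add_distrib, Finset.mul_sum, inv_pow, hp]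
  have h1 : ∑ x : Fin n, (a x : ℂ) * z ^ ((x : ℕ) + 1) = ∑ x : Fin n, z * ((a x : ℂ) * z ^ (x : ℕ)) :=
    Finset.sum_congr rfl fun i _ => by ring
  rw [h1]
  simp only [mul_assoc]
  ring

/-- Let Q = zP + kP*, so that Q* = P* + kzP, and take ‖z‖ > 1. If Q ∈ Ω and P(z) = 0, then Q(z) =
kQ*(z), against |Q*| ≤ |Q| and Q(z) ≠ 0. If P ∈ Ω and Q(z) = 0, then |z||P(z)| = |k||P*(z)| ≤
|k||P(z)|, against P(z) ≠ 0. -/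
theorem levinson_mem_Omega_iff {n : ℕ} {k : ℝ} (hk : |k| < 1) (a : Fin n → ℝ) :
    levinson n k a ∈ Omega (n + 1) ↔ a ∈ Omega n := by
  have hkn : ‖(k : ℂ)‖ < 1 := by simpa using hk
  constructor
  · intro ha z hz
    by_contra! hlt
    have hz0 : z ≠ 0 := by rintro rfl; simp at hlt; linarith
    have h1 := aeval_levinson n k a hz0
    have h2 := aeval_levinson n k a (inv_ne_zero hz0)
    rw [inv_inv] at h2
    have h3 := norm_reciprocal_le ha hlt.le
    have h4 := pow_le_norm_aeval ha hlt.le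
    have h5 : 0 < (‖z‖ - 1) ^ (n + 1) := pow_pos (by linarith) _
    have hp : z ^ n * z⁻¹ ^ n = 1 := by rw [← mul_pow, mul_inv_cancel₀ hz0, one_pow]
    have h6 : Polynomial.aeval z (monicPoly (n + 1) (levinson n k a)) =
        k * (z ^ (n + 1) * Polynomial.aeval z⁻¹ (monicPoly (n + 1) (levinson n k a))) := by
      rw [h1, h2, hz, pow_succ]
      field_simp
      simp
    rw [h6, norm_mul (k : ℂ)] at h4 h3
    nlinarith [norm_nonneg (z ^ (n + 1) * Polynomial.aeval z⁻¹ (monicPoly (n + 1) (levinson n k a))),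
      norm_nonneg (k : ℂ)]
  · intro ha z hz
    by_contra! hlt
    have hz0 : z ≠ 0 := by rintro rfl; simp at hlt; linarith
    rw [aeval_levinson n k a hz0] at hz
    have h3 := norm_reciprocal_le ha hlt.le
    have h4 := pow_le_norm_aeval ha hlt.le
    have h5 : 0 < (‖z‖ - 1) ^ n := pow_pos (by linarith) _
    have h6 := congrArg norm (eq_neg_of_add_eq_zero_left hz)
    rw [norm_neg, norm_mul, norm_mul] at h6
    nlinarith [norm_nonneg (z ^ n * Polynomial.aeval z⁻¹ (monicPoly n a)), norm_nonneg (k : ℂ)]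

/-! ### Slicing Ω_{n+1} by the constant coefficient -/

theorem lintegral_fin_succ {n : ℕ} {f : (Fin (n + 1) → ℝ) → ENNReal} (hf : Measurable f) :
    ∫⁻ a, f a = ∫⁻ x : ℝ, ∫⁻ t : Fin n → ℝ, f (Fin.cons x t) := by
  have h := (volume_preserving_piFinSuccAbove (fun _ : Fin (n + 1) => ℝ) 0).symm
  rw [← h.lintegral_comp_emb (MeasurableEquiv.measurableEmbedding _), Measure.volume_eq_prod,
    lintegral_prod]
  · refine lintegral_congr fun x => lintegral_congr fun t => ?_
    simp [MeasurableEquiv.piFinSuccAbove, Fin.consEquiv]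
  · exact (hf.comp (MeasurableEquiv.measurable _)).aemeasurable

/-- The operator `1 + k J` on `ℝ ^ n`, where `J` reverses the order of the coordinates. -/
def addRev (n : ℕ) (k : ℝ) : (Fin n → ℝ) →ₗ[ℝ] (Fin n → ℝ) :=
  LinearMap.id + k • LinearMap.funLeft ℝ ℝ Fin.rev

theorem addRev_apply (n : ℕ) (k : ℝ) (a : Fin n → ℝ) (i : Fin n) :
    addRev n k a i = a i + k * a i.rev := rfl

theorem levinson_eq_cons (n : ℕ) (k : ℝ) (a : Fin n → ℝ) :
    levinson n k a = Fin.cons k (addRev n k a) := rfl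

theorem addRev_comp_addRev_neg (n : ℕ) (k : ℝ) :
    addRev n k ∘ₗ addRev n (-k) = (1 - k ^ 2) • LinearMap.id := by
  ext a i
  simp only [LinearMap.comp_apply, addRev_apply, LinearMap.smul_apply, LinearMap.id_apply,
    Pi.smul_apply, smul_eq_mul, Fin.rev_rev]
  ring

/-- In even dimension, conjugation by alternating signs sends J to -J, so 1 + kJ and 1 - kJ have the
same determinant; their product is the scalar 1 - k². -/
theorem abs_det_addRev_even (m : ℕ) {k : ℝ} (hk : |k| < 1) :
    |LinearMap.det (addRev (2 * m) k)| = (1 - k ^ 2) ^ m := by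
  let S : (Fin (2 * m) → ℝ) →ₗ[ℝ] (Fin (2 * m) → ℝ) :=
    LinearMap.pi fun i => (-1 : ℝ) ^ (i : ℕ) • LinearMap.proj i
  have hS : ∀ a i, S a i = (-1 : ℝ) ^ (i : ℕ) * a i := fun a i => rfl
  have hpow : ∀ j : ℕ, (-1 : ℝ) ^ j * (-1) ^ j = 1 := fun j => by rw [← mul_pow]; simp
  have hSS : S ∘ₗ S = LinearMap.id := by
    refine LinearMap.ext fun a => funext fun i => ?_
    rw [LinearMap.comp_apply, hS, hS, ← mul_assoc, hpow, one_mul, LinearMap.id_apply]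
  have hrev : ∀ i : Fin (2 * m), (-1 : ℝ) ^ (i : ℕ) * (-1) ^ (i.rev : ℕ) = -1 := fun i => by
    rw [← pow_add, Fin.val_rev]
    apply Odd.neg_one_pow
    exact ⟨m - 1, by have := i.2; omega⟩
  have hconj : S ∘ₗ addRev (2 * m) k ∘ₗ S = addRev (2 * m) (-k) := by
    refine LinearMap.ext fun a => funext fun i => ?_
    simp only [LinearMap.comp_apply, hS, addRev_apply]
    linear_combination a i * hpow i + k * a i.rev * hrev i
  have d1 := congrArg LinearMap.det hSS
  have d2 := congrArg LinearMap.det hconj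
  have d3 := congrArg LinearMap.det (addRev_comp_addRev_neg (2 * m) k)
  rw [LinearMap.det_comp, LinearMap.det_id] at d1
  rw [LinearMap.det_comp, LinearMap.det_comp] at d2
  rw [LinearMap.det_comp, LinearMap.det_smul, LinearMap.det_id, Module.finrank_fin_fun, mul_one]
    at d3
  have hpos : 0 < 1 - k ^ 2 := by nlinarith [abs_lt.1 hk]
  have hsq : LinearMap.det (addRev (2 * m) k) ^ 2 = ((1 - k ^ 2) ^ m) ^ 2 := by
    rw [← pow_mul, mul_comm m 2, ← d3, ← d2]
    linear_combination -(LinearMap.det (addRev (2 * m) k) ^ 2) * d1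
  rw [sq_eq_sq_iff_abs_eq_abs] at hsq
  rw [hsq, abs_of_pos (pow_pos hpos m)]

theorem toMatrix_addRev (n : ℕ) (k : ℝ) (i j : Fin n) :
    LinearMap.toMatrix' (addRev n k) i j = (if i = j then 1 else 0) + k * if i.rev = j then 1 else 0 := by
  simp [LinearMap.toMatrix'_apply, addRev_apply, Pi.single_apply]

/-- The middle coordinate is fixed by reversal: its row has the single entry 1 + k, and expanding
along it leaves the even case. -/
theorem det_addRev_odd (m : ℕ) (k : ℝ) :
    LinearMap.det (addRev (2 * m + 1) k) = (1 + k) * LinearMap.det (addRev (2 * m) k) := by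
  let c : Fin (2 * m + 1) := ⟨m, by omega⟩
  have hc : c.rev = c := by ext; simp [c, Fin.val_rev]; omega
  rw [← LinearMap.det_toMatrix', ← LinearMap.det_toMatrix', Matrix.det_succ_row _ c,
    Finset.sum_eq_single c]
  · have hsub : (LinearMap.toMatrix' (addRev (2 * m + 1) k)).submatrix c.succAbove c.succAbove =
        LinearMap.toMatrix' (addRev (2 * m) k) := by
      ext i j
      rw [Matrix.submatrix_apply, toMatrix_addRev, toMatrix_addRev, Fin.rev_succAbove, hc]
      simp only [Fin.succAbove_right_inj]
    rw [hsub, toMatrix_addRev, hc, ← two_mul, pow_mul]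
    simp
  · intro j _ hj
    rw [toMatrix_addRev, hc, if_neg hj.symm]
    simp
  · simp

theorem volume_slice_Omega {n : ℕ} {k : ℝ} (hk : |k| < 1) :
    volume {t : Fin n → ℝ | (Fin.cons k t : Fin (n + 1) → ℝ) ∈ Omega (n + 1)} =
      ENNReal.ofReal |LinearMap.det (addRev n k)| * volume (Omega n) := by
  rw [← Measure.addHaar_image_linearMap]
  congr 1
  have hpos : 1 - k ^ 2 ≠ 0 := by nlinarith [abs_lt.1 hk]
  ext t
  simp only [Set.mem_ofPred_eq, Set.mem_image]
  constructor
  · intro ht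
    have hinv : addRev n k ((1 - k ^ 2)⁻¹ • addRev n (-k) t) = t := by
      rw [map_smul]
      have := LinearMap.congr_fun (addRev_comp_addRev_neg n k) t
      rw [LinearMap.comp_apply] at this
      rw [this, LinearMap.smul_apply, LinearMap.id_apply, inv_smul_smul₀ hpos]
    refine ⟨_, ?_, hinv⟩
    rw [← levinson_mem_Omega_iff hk, levinson_eq_cons, hinv]
    exact ht
  · rintro ⟨a, ha, rfl⟩
    rw [← levinson_eq_cons, levinson_mem_Omega_iff hk]
    exact ha

/-- Fubini in the constant coefficient. Up to sign it is the product of the roots, so slices outside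
[-1, 1] are empty; the endpoints, where 1 + kJ degenerates for n ≥ 2, are null. -/
theorem volume_Omega_succ (n : ℕ) :
    volume (Omega (n + 1)) =
      (∫⁻ k in Set.Ioo (-1 : ℝ) 1, ENNReal.ofReal |LinearMap.det (addRev n k)|) *
        volume (Omega n) := by
  rw [← lintegral_indicator_one (measurableSet_Omega _),
    lintegral_fin_succ (measurable_one.indicator (measurableSet_Omega _)),
    ← lintegral_mul_const', ← lintegral_indicator measurableSet_Ioo]
  · apply lintegral_congr_ae
    have h1 : ∀ᵐ k : ℝ, k ≠ 1 := by simp [ae_iff]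
    have h2 : ∀ᵐ k : ℝ, k ≠ -1 := by simp [ae_iff]
    filter_upwards [h1, h2] with k hk1 hk2
    have hm : MeasurableSet {t : Fin n → ℝ | (Fin.cons k t : Fin (n + 1) → ℝ) ∈ Omega (n + 1)} :=
      (measurableSet_Omega (n + 1)).preimage (by fun_prop)
    have e : (∫⁻ t : Fin n → ℝ, (Omega (n + 1)).indicator (1 : (Fin (n + 1) → ℝ) → ENNReal) (Fin.cons k t)) =
        volume {t : Fin n → ℝ | (Fin.cons k t : Fin (n + 1) → ℝ) ∈ Omega (n + 1)} := by
      rw [← lintegral_indicator_one hm]; rfl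
    rw [e]
    by_cases hk : k ∈ Set.Ioo (-1 : ℝ) 1
    · rw [Set.indicator_of_mem hk, volume_slice_Omega (abs_lt.2 hk)]
    · rw [Set.indicator_of_notMem hk]
      convert measure_empty (μ := (volume : Measure (Fin n → ℝ)))
      ext t
      simp only [Set.mem_ofPred_eq, Set.mem_empty_iff_false, iff_false]
      intro ht
      have := abs_le.1 (abs_constCoeff_le ht)
      rw [Fin.cons_zero] at this
      exact hk ⟨lt_of_le_of_ne this.1 (Ne.symm hk2), lt_of_le_of_ne this.2 hk1⟩
  · exact (isCompact_Omega n).measure_lt_top.ne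

/-! ### Central binomial weights and the ratio of volumes -/

/-- The normalised central binomial coefficient. -/
noncomputable def ncb (k : ℕ) : ℝ := (Nat.centralBinom k : ℝ) / 4 ^ k

theorem ncb_zero : ncb 0 = 1 := by simp [ncb]

theorem ncb_pos (k : ℕ) : 0 < ncb k := by
  have := Nat.centralBinom_pos k
  unfold ncb; positivity

theorem ncb_succ (k : ℕ) : (2 * (k : ℝ) + 2) * ncb (k + 1) = (2 * k + 1) * ncb k := by
  have h : ((k : ℝ) + 1) * (Nat.centralBinom (k + 1) : ℝ) = 2 * (2 * k + 1) * Nat.centralBinom k := by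
    exact_mod_cast Nat.succ_mul_centralBinom_succ k
  unfold ncb
  rw [pow_succ]
  field_simp
  linear_combination 2 * h

theorem hasDerivAt_one_sub_sq_pow (m : ℕ) (x : ℝ) :
    HasDerivAt (fun x : ℝ => (1 - x ^ 2) ^ (m + 1)) (-(2 * (m + 1)) * (x * (1 - x ^ 2) ^ m)) x := by
  have h : HasDerivAt (fun x : ℝ => 1 - x ^ 2) (-(2 * x)) x := by
    simpa using (hasDerivAt_pow 2 x).const_sub 1
  refine (h.pow (m + 1)).congr_deriv ?_
  rw [Nat.add_sub_cancel]
  push_cast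
  ring

theorem integral_one_sub_sq_pow (m : ℕ) :
    ∫ x in (-1 : ℝ)..1, (1 - x ^ 2) ^ m = 2 / ((2 * m + 1) * ncb m) := by
  induction m with
  | zero => norm_num [ncb_zero]
  | succ m ih =>
    -- This primitive vanishes at ±1, so its derivative gives the reduction formula relating the
    -- exponents m and m + 1.
    have hd : ∀ x ∈ Set.uIcc (-1 : ℝ) 1, HasDerivAt (fun x : ℝ => x * (1 - x ^ 2) ^ (m + 1))
        ((2 * m + 3) * (1 - x ^ 2) ^ (m + 1) - (2 * m + 2) * (1 - x ^ 2) ^ m) x := fun x _ => by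
      refine ((hasDerivAt_id x).mul (hasDerivAt_one_sub_sq_pow m x)).congr_deriv ?_
      rw [id, pow_succ]
      ring
    have h := intervalIntegral.integral_eq_sub_of_hasDerivAt hd
      (Continuous.intervalIntegrable (by fun_prop) _ _)
    rw [intervalIntegral.integral_sub (Continuous.intervalIntegrable (by fun_prop) _ _)
      (Continuous.intervalIntegrable (by fun_prop) _ _), intervalIntegral.integral_const_mul,
      intervalIntegral.integral_const_mul, ih] at h
    norm_num at h
    have hs := ncb_succ m
    have p1 := ncb_pos m
    have p2 := ncb_pos (m + 1)
    rw [sub_eq_zero, mul_comm, ← eq_div_iff (by positivity)] at h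
    rw [h]
    push_cast
    field_simp
    linear_combination (2 * (m : ℝ) + 3) * hs

/-- For odd n the extra factor 1 + k only adds the odd function k(1 - k²)^m, of integral zero, so
both parities give the same value. -/
theorem integral_abs_det_addRev (n : ℕ) :
    ∫ k in (-1 : ℝ)..1, |LinearMap.det (addRev n k)| =
      2 / ((2 * (n / 2 : ℕ) + 1) * ncb (n / 2)) := by
  rcases Nat.even_or_odd' n with ⟨m, rfl | rfl⟩
  · rw [Nat.mul_div_cancel_left _ two_pos, ← integral_one_sub_sq_pow]
    apply intervalIntegral.integral_congr_ae
    have h1 : ∀ᵐ k : ℝ, k ≠ 1 := by simp [ae_iff]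
    filter_upwards [h1] with k hk1 hk
    rw [Set.uIoc_of_le (by norm_num)] at hk
    exact abs_det_addRev_even m (abs_lt.2 ⟨hk.1, lt_of_le_of_ne hk.2 hk1⟩)
  · have hm : (2 * m + 1) / 2 = m := by omega
    rw [hm, ← integral_one_sub_sq_pow]
    have hd : ∀ x ∈ Set.uIcc (-1 : ℝ) 1, HasDerivAt
        (fun x : ℝ => -(2 * ((m : ℝ) + 1))⁻¹ * (1 - x ^ 2) ^ (m + 1)) (x * (1 - x ^ 2) ^ m) x := fun x _ => by
      refine ((hasDerivAt_one_sub_sq_pow m x).const_mul (-(2 * ((m : ℝ) + 1))⁻¹)).congr_deriv ?_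
      field_simp
    have h := intervalIntegral.integral_eq_sub_of_hasDerivAt hd
      (Continuous.intervalIntegrable (by fun_prop) _ _)
    norm_num at h
    have e : ∫ x in (-1 : ℝ)..1, (1 - x ^ 2) ^ m =
        ∫ x in (-1 : ℝ)..1, ((1 - x ^ 2) ^ m + x * (1 - x ^ 2) ^ m) := by
      rw [intervalIntegral.integral_add (Continuous.intervalIntegrable (by fun_prop) _ _)
        (Continuous.intervalIntegrable (by fun_prop) _ _), h, add_zero]
    rw [e]
    apply intervalIntegral.integral_congr_ae
    have h1 : ∀ᵐ k : ℝ, k ≠ 1 := by simp [ae_iff]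
    filter_upwards [h1] with k hk1 hk
    rw [Set.uIoc_of_le (by norm_num)] at hk
    rw [det_addRev_odd, abs_mul, abs_det_addRev_even m (abs_lt.2 ⟨hk.1, lt_of_le_of_ne hk.2 hk1⟩),
      abs_of_pos (by linarith [hk.1])]
    ring

theorem D_zero : D 0 = 1 := by
  have : Omega 0 = Set.univ := by
    ext a; simp [Omega, monicPoly]
  simp [D, this, Measure.real, Measure.volume_pi_eq_dirac (0 : Fin 0 → ℝ)]

theorem continuous_det_addRev (n : ℕ) : Continuous fun k => LinearMap.det (addRev n k) := by
  simp only [← LinearMap.det_toMatrix']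
  apply Continuous.matrix_det
  apply continuous_matrix
  intro i j
  simp only [toMatrix_addRev]
  fun_prop

theorem D_succ (n : ℕ) : D (n + 1) = 2 / ((2 * (n / 2 : ℕ) + 1) * ncb (n / 2)) * D n := by
  rw [D, D, Measure.real, volume_Omega_succ, ENNReal.toReal_mul, ← integral_abs_det_addRev,
    intervalIntegral.integral_of_le (by norm_num), integral_Ioc_eq_integral_Ioo,
    integral_eq_lintegral_of_nonneg_ae]
  · rfl
  · exact Eventually.of_forall fun _ => abs_nonneg _
  · exact (continuous_det_addRev n).abs.aestronglyMeasurable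

theorem D_pos (n : ℕ) : 0 < D n := by
  induction n with
  | zero => simp [D_zero]
  | succ n ih =>
    rw [D_succ]
    have := ncb_pos (n / 2)
    positivity

/-! ### Area formula with multiplicities -/

section AreaFormula

variable {E : Type*} [NormedAddCommGroup E] [NormedSpace ℝ E] [FiniteDimensional ℝ E]

theorem exists_nhds_injOn_of_det_fderiv_ne_zero {f : E → E} (hf : ContDiff ℝ 1 f) {x : E}
    (hx : (fderiv ℝ f x).det ≠ 0) : ∃ U : Set E, x ∈ U ∧ IsOpen U ∧ Set.InjOn f U := by
  have : CompleteSpace E := FiniteDimensional.complete ℝ E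
  have hs : HasStrictFDerivAt f
      (ContinuousLinearMap.toContinuousLinearEquivOfDetNeZero (fderiv ℝ f x) hx : E →L[ℝ] E) x := by
    rw [ContinuousLinearMap.coe_toContinuousLinearEquivOfDetNeZero]
    exact hf.contDiffAt.hasStrictFDerivAt (by norm_num)
  exact ⟨(hs.toOpenPartialHomeomorph f).source, hs.mem_toOpenPartialHomeomorph_source,
    (hs.toOpenPartialHomeomorph f).open_source, (hs.toOpenPartialHomeomorph f).injOn⟩

theorem exists_seq_open_injOn {f : E → E} (hf : ContDiff ℝ 1 f) :
    ∃ V : ℕ → Set E, (∀ n, IsOpen (V n)) ∧ (∀ n, Set.InjOn f (V n)) ∧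
      {x | (fderiv ℝ f x).det ≠ 0} ⊆ ⋃ n, V n := by
  choose! U hU1 hU2 hU3 using
    fun x (hx : x ∈ {x | (fderiv ℝ f x).det ≠ 0}) => exists_nhds_injOn_of_det_fderiv_ne_zero hf hx
  have : ProperSpace E := FiniteDimensional.proper_real E
  obtain ⟨t, hts, htc, ht⟩ := TopologicalSpace.countable_cover_nhdsWithin
    (s := {x | (fderiv ℝ f x).det ≠ 0}) (f := U)
    (fun x hx => mem_nhdsWithin_of_mem_nhds ((hU2 x hx).mem_nhds (hU1 x hx)))
  rcases t.eq_empty_or_nonempty with rfl | hne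
  · refine ⟨fun _ => ∅, fun _ => isOpen_empty, fun _ => Set.injOn_empty f, ?_⟩
    simpa using ht
  · obtain ⟨u, rfl⟩ := htc.exists_eq_range hne
    refine ⟨fun n => U (u n), fun n => hU2 _ (hts ⟨n, rfl⟩), fun n => hU3 _ (hts ⟨n, rfl⟩), ?_⟩
    simpa using ht

variable [MeasurableSpace E] [BorelSpace E] (μ : Measure E) [μ.IsAddHaarMeasure]

/-- Sard's theorem in equal dimensions: the image of the critical set is null. -/
theorem ae_det_fderiv_ne_zero {f : E → E} (hf : ContDiff ℝ 1 f) :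
    ∀ᵐ y ∂μ, ∀ x, f x = y → (fderiv ℝ f x).det ≠ 0 := by
  have h := addHaar_image_eq_zero_of_det_fderivWithin_eq_zero μ (f := f) (f' := fderiv ℝ f)
    (s := {x | (fderiv ℝ f x).det = 0})
    (fun x _ => ((hf.differentiable (by norm_num)) x).hasFDerivAt.hasFDerivWithinAt)
    (fun x hx => hx)
  filter_upwards [compl_mem_ae_iff.2 h] with y hy x hxy hdet
  exact hy ⟨x, hdet, hxy⟩

/-- The area formula, with multiplicities, for a `C¹` map between spaces of the same dimension. -/
theorem lintegral_count_preimage {f : E → E} (hf : ContDiff ℝ 1 f) {s : Set E}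
    (hs : MeasurableSet s) :
    AEMeasurable (fun y => Measure.count (s ∩ f ⁻¹' {y})) μ ∧
      ∫⁻ y, Measure.count (s ∩ f ⁻¹' {y}) ∂μ =
        ∫⁻ x in s, ENNReal.ofReal |(fderiv ℝ f x).det| ∂μ := by
  obtain ⟨V, hVo, hVi, hVc⟩ := exists_seq_open_injOn hf
  have hfd : Continuous fun x => (fderiv ℝ f x).det :=
    ContinuousLinearMap.continuous_det.comp (hf.continuous_fderiv (by norm_num))
  have hdm : MeasurableSet {x | (fderiv ℝ f x).det = 0} :=
    (isClosed_eq hfd continuous_const).measurableSet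
  have hdne : MeasurableSet {x | (fderiv ℝ f x).det ≠ 0} := hdm.compl
  set s' := s ∩ {x | (fderiv ℝ f x).det ≠ 0} with hs'
  have hs'm : MeasurableSet s' := hs.inter hdne
  -- The regular points are cut into countably many disjoint measurable pieces on which f is
  -- injective; a fibre then meets each piece in at most one point, and its cardinality is a sum of
  -- indicators of images.
  set A : ℕ → Set E := fun n => s' ∩ disjointed V n with hA
  have hAm : ∀ n, MeasurableSet (A n) := fun n =>
    hs'm.inter (MeasurableSet.disjointed (fun n => (hVo n).measurableSet) n)
  have hAd : Pairwise (Function.onFun Disjoint A) := fun i j hij =>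
    ((disjoint_disjointed V) hij).mono Set.inter_subset_right Set.inter_subset_right
  have hAU : ⋃ n, A n = s' := by
    rw [hA, ← Set.inter_iUnion, iUnion_disjointed]
    exact Set.inter_eq_left.2 (Set.inter_subset_right.trans hVc)
  have hAi : ∀ n, Set.InjOn f (A n) := fun n =>
    (hVi n).mono (Set.inter_subset_right.trans (disjointed_subset V n))
  have hder : ∀ n, ∀ x ∈ A n, HasFDerivWithinAt f (fderiv ℝ f x) (A n) x := fun n x _ =>
    ((hf.differentiable (by norm_num)) x).hasFDerivAt.hasFDerivWithinAt
  have hIm : ∀ n, MeasurableSet (f '' A n) := fun n =>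
    measurable_image_of_fderivWithin (hAm n) (hder n) (hAi n)
  have hcount : ∀ n y, Measure.count (A n ∩ f ⁻¹' {y}) = (f '' A n).indicator 1 y := by
    intro n y
    by_cases hy : y ∈ f '' A n
    · rw [Set.indicator_of_mem hy]
      obtain ⟨x, hx, rfl⟩ := hy
      have : A n ∩ f ⁻¹' {f x} = {x} := by
        ext z
        simp only [Set.mem_inter_iff, Set.mem_preimage, Set.mem_singleton_iff]
        exact ⟨fun h => hAi n h.1 hx h.2, by rintro rfl; exact ⟨hx, rfl⟩⟩
      rw [this, Measure.count_singleton]; rfl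
    · rw [Set.indicator_of_notMem hy]
      have : A n ∩ f ⁻¹' {y} = ∅ := by
        ext z
        simp only [Set.mem_inter_iff, Set.mem_preimage, Set.mem_singleton_iff,
          Set.mem_empty_iff_false, iff_false]
        rintro ⟨h1, h2⟩
        exact hy ⟨z, h1, h2⟩
      rw [this, measure_empty]
  have hae : (fun y => Measure.count (s ∩ f ⁻¹' {y})) =ᵐ[μ]
      fun y => ∑' n, (f '' A n).indicator 1 y := by
    filter_upwards [ae_det_fderiv_ne_zero μ hf] with y hy
    have h1 : s ∩ f ⁻¹' {y} = ⋃ n, (A n ∩ f ⁻¹' {y}) := by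
      rw [← Set.iUnion_inter, hAU]
      ext x
      simp only [hs', Set.mem_inter_iff, Set.mem_preimage, Set.mem_singleton_iff,
        Set.mem_ofPred_eq]
      exact ⟨fun h => ⟨⟨h.1, hy x h.2⟩, h.2⟩, fun h => ⟨h.1.1, h.2⟩⟩
    rw [h1, measure_iUnion]
    · simp only [hcount]
    · exact fun i j hij => (hAd hij).mono Set.inter_subset_left Set.inter_subset_left
    · exact fun n => (hAm n).inter (hf.continuous.measurable (measurableSet_singleton y))
  have hmeas : ∀ n, Measurable ((f '' A n).indicator (1 : E → ENNReal)) := fun n =>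
    measurable_one.indicator (hIm n)
  refine ⟨⟨_, Measurable.tsum hmeas, hae⟩, ?_⟩
  rw [lintegral_congr_ae hae, lintegral_tsum fun n => (hmeas n).aemeasurable]
  have e1 : ∀ n, ∫⁻ y, (f '' A n).indicator 1 y ∂μ =
      ∫⁻ x in A n, ENNReal.ofReal |(fderiv ℝ f x).det| ∂μ := fun n => by
    rw [lintegral_indicator_one (hIm n),
      lintegral_abs_det_fderiv_eq_addHaar_image μ (hAm n) (hder n) (hAi n)]
  simp only [e1]
  rw [← lintegral_iUnion hAm hAd, hAU, ← lintegral_inter_add_sdiff (B := {x | (fderiv ℝ f x).det ≠ 0})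
    (fun x => ENNReal.ofReal |(fderiv ℝ f x).det|) s hdne]
  have e2 : ∫⁻ x in s \ {x | (fderiv ℝ f x).det ≠ 0}, ENNReal.ofReal |(fderiv ℝ f x).det| ∂μ = 0 := by
    rw [setLIntegral_congr_fun (g := fun _ => 0) (hs.diff hdne), lintegral_zero]
    intro x hx
    have : (fderiv ℝ f x).det = 0 := not_not.1 hx.2
    simp [this]
  rw [e2, add_zero]

end AreaFormula

/-! ### Kac formula for the number of real roots -/

/-- The map sending `(T, a₁, …, aₙ)` to the coefficient vector `(a₀, a₁, …, aₙ)` of the monic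
polynomial of degree `n + 1` that vanishes at `T`. -/
def rootMap (n : ℕ) (t : Fin (n + 1) → ℝ) : Fin (n + 1) → ℝ :=
  Fin.cons (-(t 0 ^ (n + 1) + ∑ i : Fin n, t i.succ * t 0 ^ ((i : ℕ) + 1))) (Fin.tail t)

/-- Consequently the fibre of `rootMap` over a is in bijection with the distinct real roots of the
polynomial. -/
theorem rootMap_eq_iff {n : ℕ} (t a : Fin (n + 1) → ℝ) :
    rootMap n t = a ↔ Fin.tail t = Fin.tail a ∧ (monicPoly (n + 1) a).eval (t 0) = 0 := by
  rw [eval_monicPoly, Fin.sum_univ_succ, ← Fin.cons_self_tail a, rootMap, Fin.cons_inj]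
  simp only [Fin.cons_zero, Fin.cons_succ, Fin.tail_cons, Fin.val_zero, pow_zero, mul_one,
    Fin.val_succ]
  constructor
  · rintro ⟨h1, h2⟩
    refine ⟨h2, ?_⟩
    rw [← h2, ← h1]
    simp [Fin.tail]
  · rintro ⟨h1, h2⟩
    refine ⟨?_, h1⟩
    rw [← h1] at h2
    simp only [Fin.tail] at h2
    linear_combination -h2

theorem derivative_eval_monicPoly_succ (n : ℕ) (a : Fin (n + 1) → ℝ) (x : ℝ) :
    (Polynomial.derivative (monicPoly (n + 1) a)).eval x =
      (n + 1) * x ^ n + ∑ i : Fin n, a i.succ * ((i + 1) * x ^ (i : ℕ)) := by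
  simp [monicPoly, Fin.sum_univ_succ, Polynomial.eval_finsetSum]

/-- The Jacobian matrix of `rootMap`. -/
noncomputable def rootMapJacobian (n : ℕ) (t : Fin (n + 1) → ℝ) :
    Matrix (Fin (n + 1)) (Fin (n + 1)) ℝ := fun i j =>
  Fin.cases (Fin.cases (-(Polynomial.derivative (monicPoly (n + 1) (rootMap n t))).eval (t 0))
    (fun j' : Fin n => -t 0 ^ ((j' : ℕ) + 1)) j) (fun i' : Fin n => if i'.succ = j then 1 else 0) i

theorem det_rootMapJacobian (n : ℕ) (t : Fin (n + 1) → ℝ) :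
    (rootMapJacobian n t).det =
      -(Polynomial.derivative (monicPoly (n + 1) (rootMap n t))).eval (t 0) := by
  rw [Matrix.det_of_isUpperTriangular, Fin.prod_univ_succ]
  · simp [rootMapJacobian]
  · intro i j hij
    induction i using Fin.cases with
    | zero => simp at hij
    | succ i =>
      simp only [id] at hij
      simp [rootMapJacobian, hij.ne']

theorem hasFDerivAt_rootMap (n : ℕ) (t : Fin (n + 1) → ℝ) :
    HasFDerivAt (rootMap n)
      (LinearMap.toContinuousLinearMap (Matrix.toLin' (rootMapJacobian n t))) t := by
  rw [hasFDerivAt_pi']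
  intro i
  induction i using Fin.cases with
  | zero =>
    have h0 : HasFDerivAt (fun t : Fin (n + 1) → ℝ => t 0)
        (ContinuousLinearMap.proj (R := ℝ) (φ := fun _ => ℝ) 0) t := hasFDerivAt_apply 0 t
    have hp : ∀ k : ℕ, HasFDerivAt (fun t : Fin (n + 1) → ℝ => t 0 ^ k) _ t := fun k => h0.pow k
    have hi : ∀ i : Fin n, HasFDerivAt (fun t : Fin (n + 1) → ℝ => t i.succ * t 0 ^ ((i : ℕ) + 1))
        _ t := fun i => HasFDerivAt.fun_mul
          (hasFDerivAt_apply (𝕜 := ℝ) (F' := fun _ : Fin (n + 1) => ℝ) i.succ t)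
          (hp ((i : ℕ) + 1))
    have h := ((hp (n + 1)).fun_add
      (HasFDerivAt.fun_sum (u := Finset.univ) fun (i : Fin n) _ => hi i)).fun_neg
    refine h.congr_fderiv ?_
    ext v
    simp [Matrix.toLin'_apply, Matrix.mulVec, dotProduct, Fin.sum_univ_succ, rootMapJacobian,
      derivative_eval_monicPoly_succ, rootMap, Fin.tail, Finset.sum_add_distrib, Finset.sum_mul,
      add_mul]
    have e : ∑ x : Fin n, t x.succ * ((x : ℕ) * t 0 ^ (x : ℕ) * v 0 + t 0 ^ (x : ℕ) * v 0) =
        ∑ x : Fin n, t x.succ * ((x : ℕ) * t 0 ^ (x : ℕ) + t 0 ^ (x : ℕ)) * v 0 :=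
      Finset.sum_congr rfl fun _ _ => by ring
    rw [e]
    ring
  | succ i =>
    refine (hasFDerivAt_apply i.succ t).congr_fderiv ?_
    ext v
    simp [Matrix.toLin'_apply, Matrix.mulVec, dotProduct, rootMapJacobian]

theorem contDiff_rootMap (n : ℕ) : ContDiff ℝ 1 (rootMap n) := by
  rw [contDiff_pi]
  intro i
  induction i using Fin.cases with
  | zero => simp only [rootMap, Fin.cons_zero]; fun_prop
  | succ i => simp only [rootMap, Fin.cons_succ, Fin.tail]; fun_prop

theorem det_fderiv_rootMap (n : ℕ) (t : Fin (n + 1) → ℝ) :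
    (fderiv ℝ (rootMap n) t).det =
      -(Polynomial.derivative (monicPoly (n + 1) (rootMap n t))).eval (t 0) := by
  rw [(hasFDerivAt_rootMap n t).fderiv, ← det_rootMapJacobian, ← LinearMap.det_toLin']
  rfl

/-- A multiple real root is a critical point of `rootMap`, since the Jacobian is -P'(T). By Sard
almost every P has only simple real roots, so counting the fibre agrees with counting
multiplicities. -/
theorem ae_count_rootMap_preimage (n : ℕ) :
    ∀ᵐ a : Fin (n + 1) → ℝ, Measure.count ((rootMap n ⁻¹' Omega (n + 1)) ∩ rootMap n ⁻¹' {a}) =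
      (Omega (n + 1)).indicator (fun a => (numRealRoots (n + 1) a : ENNReal)) a := by
  filter_upwards [ae_det_fderiv_ne_zero volume (contDiff_rootMap n)] with a ha
  by_cases haΩ : a ∈ Omega (n + 1)
  · rw [Set.indicator_of_mem haΩ]
    have hP := (monic_monicPoly (n + 1) a).ne_zero
    have hset : (rootMap n ⁻¹' Omega (n + 1)) ∩ rootMap n ⁻¹' {a} =
        (fun x : ℝ => (Fin.cons x (Fin.tail a) : Fin (n + 1) → ℝ)) ''
          ((monicPoly (n + 1) a).roots.toFinset : Set ℝ) := by
      ext t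
      simp only [Set.mem_inter_iff, Set.mem_preimage, Set.mem_singleton_iff, Set.mem_image,
        Finset.mem_coe, Multiset.mem_toFinset, Polynomial.mem_roots hP, Polynomial.IsRoot]
      constructor
      · rintro ⟨-, h⟩
        rw [rootMap_eq_iff] at h
        exact ⟨t 0, h.2, by rw [← h.1, Fin.cons_self_tail]⟩
      · rintro ⟨x, hx, rfl⟩
        have h : rootMap n (Fin.cons x (Fin.tail a)) = a := by
          rw [rootMap_eq_iff]; exact ⟨by simp, by simpa using hx⟩
        exact ⟨by rwa [h], h⟩
    have hinj : Function.Injective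
        (fun x : ℝ => (Fin.cons x (Fin.tail a) : Fin (n + 1) → ℝ)) := fun x y h => by
      simpa using congrFun h 0
    have hnd : (monicPoly (n + 1) a).roots.Nodup := by
      rw [Multiset.nodup_iff_count_le_one]
      intro x
      rw [Polynomial.count_roots]
      by_contra! hlt
      rw [Polynomial.one_lt_rootMultiplicity_iff_isRoot hP] at hlt
      have h : rootMap n (Fin.cons x (Fin.tail a)) = a := by
        rw [rootMap_eq_iff]; exact ⟨by simp, by simpa using hlt.1⟩
      apply ha _ h
      rw [det_fderiv_rootMap, h, neg_eq_zero]
      exact hlt.2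
    rw [hset, Measure.count_injective_image hinj, Measure.count_apply_finset, numRealRoots,
      Multiset.toFinset_card_of_nodup hnd]
  · rw [Set.indicator_of_notMem haΩ]
    have : (rootMap n ⁻¹' Omega (n + 1)) ∩ rootMap n ⁻¹' {a} = ∅ := by
      ext t
      simp only [Set.mem_inter_iff, Set.mem_preimage, Set.mem_singleton_iff,
        Set.mem_empty_iff_false, iff_false]
      rintro ⟨h1, h2⟩
      exact haΩ (h2 ▸ h1)
    rw [this, measure_empty]

theorem measurableSet_rootMap_preimage (n : ℕ) : MeasurableSet (rootMap n ⁻¹' Omega (n + 1)) :=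
  (measurableSet_Omega (n + 1)).preimage (contDiff_rootMap n).continuous.measurable

theorem aemeasurable_numRealRoots (n : ℕ) :
    AEMeasurable (fun a => (numRealRoots (n + 1) a : ENNReal)) (volume.restrict (Omega (n + 1))) := by
  rw [← aemeasurable_indicator_iff (measurableSet_Omega _)]
  exact (lintegral_count_preimage volume (contDiff_rootMap n)
    (measurableSet_rootMap_preimage n)).1.congr (ae_count_rootMap_preimage n)

theorem lintegral_numRealRoots (n : ℕ) :
    ∫⁻ a in Omega (n + 1), (numRealRoots (n + 1) a : ENNReal) =
      ∫⁻ t in rootMap n ⁻¹' Omega (n + 1), ENNReal.ofReal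
        |(Polynomial.derivative (monicPoly (n + 1) (rootMap n t))).eval (t 0)| := by
  rw [← lintegral_indicator (measurableSet_Omega _),
    ← lintegral_congr_ae (ae_count_rootMap_preimage n),
    (lintegral_count_preimage volume (contDiff_rootMap n) (measurableSet_rootMap_preimage n)).2]
  simp only [det_fderiv_rootMap, abs_neg]

/-- The coefficients of positive index of `(x - T) Q(x)`, where `Q` is the monic polynomial with
coefficient vector `b`. -/
noncomputable def shear (n : ℕ) (T : ℝ) (b : Fin n → ℝ) : Fin n → ℝ :=
  fun i => b i - T * (monicPoly n b).coeff (i + 1)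

open Polynomial in
theorem monicPoly_rootMap_shear (n : ℕ) (T : ℝ) (b : Fin n → ℝ) :
    monicPoly (n + 1) (rootMap n (Fin.cons T (shear n T b))) = (X - C T) * monicPoly n b := by
  have hm : ((X - C T) * monicPoly n b).Monic := (monic_X_sub_C T).mul (monic_monicPoly n b)
  have hd : ((X - C T) * monicPoly n b).natDegree = n + 1 := by
    rw [(monic_X_sub_C T).natDegree_mul (monic_monicPoly n b), natDegree_monicPoly,
      natDegree_X_sub_C, add_comm]
  have e := eq_monicPoly_of_monic hm hd
  rw [← e]
  congr 1
  rw [rootMap_eq_iff, e]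
  constructor
  · rw [Fin.tail_cons]
    funext i
    simp [Fin.tail, shear, sub_mul, coeff_X_mul, coeff_monicPoly, i.2]
  · simp

theorem rootMap_shear_mem_Omega_iff (n : ℕ) (T : ℝ) (b : Fin n → ℝ) :
    rootMap n (Fin.cons T (shear n T b)) ∈ Omega (n + 1) ↔ T ∈ Set.Icc (-1 : ℝ) 1 ∧ b ∈ Omega n := by
  simp only [Omega, Set.mem_ofPred_eq, monicPoly_rootMap_shear, map_mul, mul_eq_zero, map_sub,
    Polynomial.aeval_X, Polynomial.aeval_C]
  constructor
  · intro h
    refine ⟨?_, fun z hz => h z (Or.inr hz)⟩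
    have := h (T : ℂ) (Or.inl (by simp))
    rw [Complex.norm_real] at this
    exact abs_le.1 this
  · rintro ⟨h1, h2⟩ z (hz | hz)
    · rw [sub_eq_zero.1 hz]
      simpa using abs_le.2 h1
    · exact h2 z hz

/-- Multiplication by x - T acts on the coefficients by a unipotent bidiagonal matrix followed by a
translation. -/
theorem measurePreserving_shear (n : ℕ) (T : ℝ) :
    MeasurePreserving (shear n T) volume volume := by
  let M : Matrix (Fin n) (Fin n) ℝ := fun i j =>
    (if i = j then 1 else 0) - T * if (i : ℕ) + 1 = j then 1 else 0
  -- The translation comes from the leading coefficient 1 of Q, which is met only in the top index.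
  let v : Fin n → ℝ := fun i => -(T * if (i : ℕ) + 1 = n then 1 else 0)
  have hs : shear n T = (fun x => x + v) ∘ Matrix.toLin' M := by
    funext b i
    have hM : Matrix.toLin' M b i = b i - T * ∑ j : Fin n, if (i : ℕ) + 1 = j then b j else 0 := by
      change ∑ j, M i j * b j = _
      simp only [M, sub_mul, mul_assoc, ite_mul,
        one_mul, zero_mul, Finset.sum_sub_distrib, ← Finset.mul_sum, Finset.sum_ite_eq,
        Finset.mem_univ, if_true]
    rw [Function.comp_apply, Pi.add_apply, hM]
    simp only [shear, v, monicPoly, Polynomial.coeff_add, Polynomial.coeff_X_pow,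
      Polynomial.finsetSum_coeff, Polynomial.coeff_C_mul, mul_ite, mul_one, mul_zero]
    split_ifs <;> ring
  have hdet : LinearMap.det (Matrix.toLin' M) = 1 := by
    rw [LinearMap.det_toLin', Matrix.det_of_isUpperTriangular]
    · simp [M]
    · intro i j hij
      simp only [id] at hij
      have h1 : i ≠ j := hij.ne'
      have h2 : (i : ℕ) + 1 ≠ j := by have : (j : ℕ) < i := hij; omega
      simp [M, h1, h2]
  rw [hs]
  refine (measurePreserving_add_right volume v).comp ⟨?_, ?_⟩
  · exact (LinearMap.continuous_of_finiteDimensional _).measurable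
  · rw [Real.map_linearMap_volume_pi_eq_smul_volume_pi (by rw [hdet]; norm_num), hdet]
    simp

theorem continuous_eval_monicPoly (n : ℕ) :
    Continuous fun p : ℝ × (Fin n → ℝ) => (monicPoly n p.2).eval p.1 := by
  simp only [eval_monicPoly]
  fun_prop

/-- For fixed T, change variables from the coefficients of P to those of the cofactor Q in P = (x -
T)Q; then P'(T) = Q(T). -/
theorem lintegral_numRealRoots_eq (n : ℕ) :
    ∫⁻ a in Omega (n + 1), (numRealRoots (n + 1) a : ENNReal) =
      ∫⁻ T in Set.Icc (-1 : ℝ) 1, ∫⁻ b in Omega n, ENNReal.ofReal |(monicPoly n b).eval T| := by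
  have hm : Measurable fun t : Fin (n + 1) → ℝ => ENNReal.ofReal
      |(Polynomial.derivative (monicPoly (n + 1) (rootMap n t))).eval (t 0)| := by
    have h : (fun t : Fin (n + 1) → ℝ => ENNReal.ofReal
        |(Polynomial.derivative (monicPoly (n + 1) (rootMap n t))).eval (t 0)|) = fun t =>
        ENNReal.ofReal |(fderiv ℝ (rootMap n) t).det| := by
      simp only [det_fderiv_rootMap, abs_neg]
    rw [h]
    exact (ContinuousLinearMap.continuous_det.comp
      ((contDiff_rootMap n).continuous_fderiv (by norm_num))).abs.measurable.ennreal_ofReal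
  rw [lintegral_numRealRoots, ← lintegral_indicator (measurableSet_rootMap_preimage n),
    lintegral_fin_succ (hm.indicator (measurableSet_rootMap_preimage n)),
    ← lintegral_indicator measurableSet_Icc]
  refine lintegral_congr fun T => ?_
  have hcons : Measurable fun t : Fin n → ℝ => (Fin.cons T t : Fin (n + 1) → ℝ) := by fun_prop
  rw [← (measurePreserving_shear n T).lintegral_comp
    ((hm.indicator (measurableSet_rootMap_preimage n)).fun_comp hcons)]
  by_cases hT : T ∈ Set.Icc (-1 : ℝ) 1
  · rw [Set.indicator_of_mem hT, ← lintegral_indicator (measurableSet_Omega n)]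
    refine lintegral_congr fun b => ?_
    by_cases hb : b ∈ Omega n
    · rw [Set.indicator_of_mem hb, Set.indicator_of_mem
        (show Fin.cons T (shear n T b) ∈ rootMap n ⁻¹' Omega (n + 1) from
          (rootMap_shear_mem_Omega_iff n T b).2 ⟨hT, hb⟩), monicPoly_rootMap_shear]
      simp
    · rw [Set.indicator_of_notMem hb, Set.indicator_of_notMem]
      exact fun h => hb ((rootMap_shear_mem_Omega_iff n T b).1 h).2
  · rw [Set.indicator_of_notMem hT, lintegral_eq_zero_of_ae_eq_zero]
    refine Eventually.of_forall fun b => ?_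
    beta_reduce
    rw [Set.indicator_of_notMem]
    · rfl
    · exact fun h => hT ((rootMap_shear_mem_Omega_iff n T b).1 h).1

/-- The expected number of real roots in degree `n + 1` in terms of the mean of `|P(T)|` in
degree `n`. -/
theorem expectedRealRoots_succ (n : ℕ) :
    expectedRealRoots (n + 1) =
      (2 * (n / 2 : ℕ) + 1) * ncb (n / 2) / 2 * ∫ T in (-1 : ℝ)..1, meanAbs n T := by
  have hcont : Continuous fun T : ℝ => ∫ b in Omega n, |(monicPoly n b).eval T| :=
    continuous_parametric_integral_of_continuous (continuous_eval_monicPoly n).abs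
      (isCompact_Omega n)
  have hint : ∀ T : ℝ, IntegrableOn (fun b => |(monicPoly n b).eval T|) (Omega n) := fun T =>
    ((continuous_eval_monicPoly n).abs.comp
      (Continuous.prodMk_right T)).continuousOn.integrableOn_compact (isCompact_Omega n)
  have key : ∫ a in Omega (n + 1), (numRealRoots (n + 1) a : ℝ) =
      ∫ T in (-1 : ℝ)..1, ∫ b in Omega n, |(monicPoly n b).eval T| := by
    rw [intervalIntegral.integral_of_le (by norm_num), ← integral_Icc_eq_integral_Ioc,
      integral_eq_lintegral_of_nonneg_ae (Eventually.of_forall fun _ => by positivity),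
      integral_eq_lintegral_of_nonneg_ae (Eventually.of_forall fun _ => by positivity)
        hcont.aestronglyMeasurable]
    · congr 1
      simp only [ENNReal.ofReal_natCast]
      rw [lintegral_numRealRoots_eq]
      refine lintegral_congr fun T => ?_
      rw [ofReal_integral_eq_lintegral_ofReal (hint T) (Eventually.of_forall fun _ => abs_nonneg _)]
    · have h := (aemeasurable_numRealRoots n).ennreal_toReal.aestronglyMeasurable
      simpa using h
  simp only [expectedRealRoots, meanAbs]
  rw [key, intervalIntegral.integral_const_mul, D_succ]
  have h1 := D_pos n
  have h2 := ncb_pos (n / 2)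
  field_simp

/-! ### From the conjectural means to a double sum -/

theorem ncb_eq_choose (k : ℕ) : ((2 * k).choose k : ℝ) = 4 ^ k * ncb k := by
  rw [ncb, Nat.centralBinom_eq_two_mul_choose]
  field_simp

/-- The double sum giving the expected number of real roots. -/
noncomputable def rootSum (m M : ℕ) : ℝ :=
  ∑ k ∈ Finset.range (m + 1), ∑ j ∈ Finset.range (M + 1),
    ((2 * ((m - k : ℕ) : ℝ) + 1) * ncb (m - k) * ncb k) * (ncb (M - j) * ncb j) /
      (2 * ((k + j : ℕ) : ℝ) + 1)

theorem weightedSum_eq (m : ℕ) (T : ℝ) : weightedSum m T = 4 ^ m / (2 * m + 1) *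
    ∑ k ∈ Finset.range (m + 1), (2 * ((m - k : ℕ) : ℝ) + 1) * ncb (m - k) * ncb k * T ^ (2 * k) := by
  rw [weightedSum, Finset.mul_sum]
  refine Finset.sum_congr rfl fun k hk => ?_
  have hk' : k ≤ m := by have := Finset.mem_range.1 hk; omega
  rw [← Nat.mul_sub, ncb_eq_choose, ncb_eq_choose, Nat.cast_sub hk', ← Nat.sub_add_cancel hk',
    Nat.add_sub_cancel, pow_add]
  push_cast [hk']
  ring

theorem plainSum_eq (m : ℕ) (T : ℝ) : plainSum m T = 4 ^ m *
    ∑ k ∈ Finset.range (m + 1), ncb (m - k) * ncb k * T ^ (2 * k) := by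
  rw [plainSum, Finset.mul_sum]
  refine Finset.sum_congr rfl fun k hk => ?_
  have hk' : k ≤ m := by have := Finset.mem_range.1 hk; omega
  have hp : (4 : ℝ) ^ m = 4 ^ (m - k) * 4 ^ k := by rw [← pow_add, Nat.sub_add_cancel hk']
  rw [← Nat.mul_sub, ncb_eq_choose, ncb_eq_choose, hp]
  ring

theorem integral_weightedSum_mul_plainSum (m M : ℕ) :
    ∫ T in (-1 : ℝ)..1, weightedSum m T * plainSum M T =
      4 ^ m * 4 ^ M / (2 * m + 1) * (2 * rootSum m M) := by
  have hpow : ∀ n : ℕ, ∫ T in (-1 : ℝ)..1, T ^ (2 * n) = 2 / (2 * (n : ℝ) + 1) := fun n => by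
    rw [integral_pow, pow_succ, pow_succ, pow_mul, pow_mul]
    norm_num
  have e : ∀ T : ℝ, weightedSum m T * plainSum M T = 4 ^ m * 4 ^ M / (2 * m + 1) *
      ∑ k ∈ Finset.range (m + 1), ∑ j ∈ Finset.range (M + 1),
        ((2 * ((m - k : ℕ) : ℝ) + 1) * ncb (m - k) * ncb k) * (ncb (M - j) * ncb j) *
          T ^ (2 * (k + j)) := fun T => by
    rw [weightedSum_eq, plainSum_eq, mul_mul_mul_comm, Finset.sum_mul_sum]
    rw [div_mul_eq_mul_div]
    congr 1
    refine Finset.sum_congr rfl fun k _ => Finset.sum_congr rfl fun j _ => ?_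
    rw [mul_add 2 k j, pow_add]
    ring
  simp only [e]
  rw [intervalIntegral.integral_const_mul, intervalIntegral.integral_finsetSum]
  · congr 1
    rw [rootSum, Finset.mul_sum]
    refine Finset.sum_congr rfl fun k _ => ?_
    rw [intervalIntegral.integral_finsetSum, Finset.mul_sum]
    · refine Finset.sum_congr rfl fun j _ => ?_
      rw [intervalIntegral.integral_const_mul, hpow]
      ring
    · exact fun j _ => Continuous.intervalIntegrable (by fun_prop) _ _
  · exact fun j _ => Continuous.intervalIntegrable (by fun_prop) _ _

/-- The factor (2m+1)u_m / 2 from the volumes cancels the binomial coefficient, the powers of 4 and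
the weight 1/(2m+1) of the conjectured formulas, in both parities. -/
theorem expectedRealRoots_succ_eq_rootSum (hconj : AbsoluteConjecture) (n : ℕ) :
    expectedRealRoots (n + 1) = rootSum (n / 2) ((n + 1) / 2) := by
  rw [expectedRealRoots_succ]
  rcases Nat.even_or_odd' n with ⟨m, rfl | rfl⟩
  · have e1 : 2 * m / 2 = m := by omega
    have e2 : (2 * m + 1) / 2 = m := by omega
    have h : ∫ T in (-1 : ℝ)..1, meanAbs (2 * m) T = ∫ T in (-1 : ℝ)..1,
        1 / (2 ^ (2 * m) * ((2 * m).choose m : ℝ)) * (weightedSum m T * plainSum m T) := by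
      refine intervalIntegral.integral_congr fun T hT => ?_
      rw [Set.uIcc_of_le (by norm_num)] at hT
      simp only [hconj.1 m T hT, mul_assoc]
    rw [h, e1, e2, intervalIntegral.integral_const_mul, integral_weightedSum_mul_plainSum,
      ncb_eq_choose, pow_mul]
    have := ncb_pos m
    norm_num
    field_simp
  · have e1 : (2 * m + 1) / 2 = m := by omega
    have e2 : (2 * m + 1 + 1) / 2 = m + 1 := by omega
    have h : ∫ T in (-1 : ℝ)..1, meanAbs (2 * m + 1) T = ∫ T in (-1 : ℝ)..1,
        1 / (2 ^ (2 * m + 2) * ((2 * m).choose m : ℝ)) * (weightedSum m T * plainSum (m + 1) T) := by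
      refine intervalIntegral.integral_congr fun T hT => ?_
      rw [Set.uIcc_of_le (by norm_num)] at hT
      simp only [hconj.2 m T hT, mul_assoc]
    rw [h, e1, e2, intervalIntegral.integral_const_mul, integral_weightedSum_mul_plainSum,
      ncb_eq_choose, pow_add, pow_mul, pow_succ]
    have := ncb_pos m
    norm_num
    field_simp
    rw [pow_succ]

/-! ### Wallis bounds for the weights -/

theorem wallis_eq (k : ℕ) : Real.Wallis.W k * ((2 * k + 1) * ncb k ^ 2) = 1 := by
  induction k with
  | zero => simp [Real.Wallis.W, ncb_zero]
  | succ k ih =>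
    have h : ncb (k + 1) = (2 * k + 1) * ncb k / (2 * (k : ℝ) + 2) := by
      rw [eq_div_iff (by positivity), ← ncb_succ]; ring
    rw [Real.Wallis.W_succ, h]
    push_cast
    field_simp
    field_simp at ih
    linear_combination (2 * (k : ℝ) + 3) * ih

theorem le_mul_ncb (k : ℕ) : 2 * √((k + 1 / 2) / Real.pi) ≤ (2 * k + 1) * ncb k := by
  have hw := Real.Wallis.W_le k
  have he := wallis_eq k
  have hu := ncb_pos k
  have hp := Real.pi_pos
  rw [← sq_le_sq₀ (by positivity) (by positivity), mul_pow, Real.sq_sqrt (by positivity)]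
  have h1 : 1 ≤ Real.pi / 2 * ((2 * k + 1) * ncb k ^ 2) := by
    exact he.symm.le.trans (mul_le_mul_of_nonneg_right hw (by positivity))
  rw [← mul_div_assoc, div_le_iff₀ hp]
  nlinarith [mul_le_mul_of_nonneg_left h1 (by positivity : (0 : ℝ) ≤ 2 * (2 * k + 1))]

theorem mul_ncb_le (k : ℕ) : (2 * k + 1) * ncb k ≤ 2 * √((k + 1) / Real.pi) := by
  have hw := Real.Wallis.le_W k
  have he := wallis_eq k
  have hu := ncb_pos k
  have hp := Real.pi_pos
  rw [← sq_le_sq₀ (by positivity) (by positivity), mul_pow 2, Real.sq_sqrt (by positivity)]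
  have h1 : (2 * (k : ℝ) + 1) / (2 * k + 2) * (Real.pi / 2) * ((2 * k + 1) * ncb k ^ 2) ≤ 1 := by
    exact (mul_le_mul_of_nonneg_right hw (by positivity)).trans he.le
  rw [← mul_div_assoc, le_div_iff₀ hp]
  have h2 : (2 * (k : ℝ) + 1) / (2 * k + 2) * (Real.pi / 2) * ((2 * k + 1) * ncb k ^ 2) =
      ((2 * k + 1) * ncb k) ^ 2 * Real.pi / (4 * (k + 1)) := by field_simp; ring
  rw [h2, div_le_one (by positivity)] at h1
  linarith

theorem one_div_le_ncb (k : ℕ) : 1 / √(Real.pi * (k + 1 / 2)) ≤ ncb k := by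
  have h := le_mul_ncb k
  have hp := Real.pi_pos
  have e : 2 * √((k + 1 / 2) / Real.pi) = (2 * k + 1) * (1 / √(Real.pi * (k + 1 / 2))) := by
    rw [Real.sqrt_div (by positivity), Real.sqrt_mul (by positivity)]
    have : (2 * (k : ℝ) + 1) = 2 * (√(k + 1 / 2) * √(k + 1 / 2)) := by
      rw [Real.mul_self_sqrt (by positivity)]; ring
    rw [this]
    have : 0 < √((k : ℝ) + 1 / 2) := by positivity
    field_simp
  rw [e] at h
  exact le_of_mul_le_mul_left h (by positivity)

theorem ncb_le_one_div {k : ℕ} (hk : 0 < k) : ncb k ≤ 1 / √(Real.pi * k) := by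
  have h := mul_ncb_le k
  have hu := ncb_pos k
  have hp := Real.pi_pos
  have hk' : (0 : ℝ) < k := by exact_mod_cast hk
  rw [← sq_le_sq₀ (by positivity) (by positivity), mul_pow 2, Real.sq_sqrt (by positivity),
    mul_pow] at h
  rw [← sq_le_sq₀ (by positivity) (by positivity), div_pow, Real.sq_sqrt (by positivity), one_pow,
    le_div_iff₀ (by positivity)]
  rw [← mul_div_assoc, le_div_iff₀ hp] at h
  have h3 : ncb k ^ 2 * (Real.pi * k) * (4 * (k + 1)) ≤ 1 * (4 * (k + 1)) := by
    have : 0 ≤ ncb k ^ 2 * Real.pi := by positivity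
    nlinarith
  exact le_of_mul_le_mul_right h3 (by positivity)

/-! ### Convolution of the weights and harmonic sums -/

/-- The u_k are the coefficients of (1 - x)^{-1/2}, whose square is the geometric series. The proof
is elementary: by symmetry the first moment is n/2 times the sum S_n, and (k+1)u_{k+1} = (k+1/2)u_k
then gives (n+1)S_{n+1} = (n+1)S_n. -/
theorem sum_antidiagonal_ncb (n : ℕ) :
    ∑ p ∈ Finset.HasAntidiagonal.antidiagonal n, ncb p.1 * ncb p.2 = 1 := by
  have hsym : ∀ n : ℕ, ∑ p ∈ Finset.HasAntidiagonal.antidiagonal n, (p.1 : ℝ) * (ncb p.1 * ncb p.2) =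
      n / 2 * ∑ p ∈ Finset.HasAntidiagonal.antidiagonal n, ncb p.1 * ncb p.2 := fun n => by
    have h1 : ∑ p ∈ Finset.HasAntidiagonal.antidiagonal n, (p.1 : ℝ) * (ncb p.1 * ncb p.2) =
        ∑ p ∈ Finset.HasAntidiagonal.antidiagonal n, (p.2 : ℝ) * (ncb p.1 * ncb p.2) := by
      rw [← Finset.Nat.sum_antidiagonal_swap]
      exact Finset.sum_congr rfl fun p _ => by simp [mul_comm (ncb p.1)]
    have h2 : ∑ p ∈ Finset.HasAntidiagonal.antidiagonal n, (p.1 : ℝ) * (ncb p.1 * ncb p.2) +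
        ∑ p ∈ Finset.HasAntidiagonal.antidiagonal n, (p.2 : ℝ) * (ncb p.1 * ncb p.2) =
        n * ∑ p ∈ Finset.HasAntidiagonal.antidiagonal n, ncb p.1 * ncb p.2 := by
      rw [← Finset.sum_add_distrib, Finset.mul_sum]
      refine Finset.sum_congr rfl fun p hp => ?_
      rw [← Finset.HasAntidiagonal.mem_antidiagonal.1 hp]
      push_cast
      ring
    linarith
  induction n with
  | zero => simp [ncb_zero]
  | succ n ih =>
    have h := hsym (n + 1)
    rw [Finset.Nat.sum_antidiagonal_succ] at h
    have h2 : ∑ p ∈ Finset.HasAntidiagonal.antidiagonal n, ((p.1 + 1 : ℕ) : ℝ) * (ncb (p.1 + 1) * ncb p.2) =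
        ∑ p ∈ Finset.HasAntidiagonal.antidiagonal n, ((p.1 : ℝ) * (ncb p.1 * ncb p.2) + 1 / 2 * (ncb p.1 * ncb p.2)) := by
      refine Finset.sum_congr rfl fun p _ => ?_
      push_cast
      linear_combination ncb p.2 / 2 * ncb_succ p.1
    rw [h2, Finset.sum_add_distrib, ← Finset.mul_sum, hsym, ih] at h
    push_cast at h
    have hn : (0 : ℝ) < n + 1 := by positivity
    have h3 : ((n : ℝ) + 1) * ∑ p ∈ Finset.HasAntidiagonal.antidiagonal (n + 1), ncb p.1 * ncb p.2 = (n + 1) * 1 := by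
      linarith
    exact mul_left_cancel₀ hn.ne' h3

theorem sum_antidiagonal_ncb_div (n : ℕ) (c : ℝ) :
    ∑ p ∈ Finset.HasAntidiagonal.antidiagonal n, ncb p.1 * ncb p.2 / c = 1 / c := by
  rw [← Finset.sum_div, sum_antidiagonal_ncb]

theorem sum_range_ncb (m : ℕ) : ∑ k ∈ Finset.range (m + 1), ncb k = (2 * m + 1) * ncb m := by
  induction m with
  | zero => simp
  | succ m ih =>
    rw [Finset.sum_range_succ, ih]
    push_cast
    linear_combination -ncb_succ m

/-- Group by k + j = n: each part of an antidiagonal contributes at most its full sum 1/(2n+1). -/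
theorem sum_product_le (m K : ℕ) :
    ∑ k ∈ Finset.range (m + 1), ∑ j ∈ Finset.range (K + 1),
      ncb k * ncb j / (2 * ((k + j : ℕ) : ℝ) + 1) ≤
    ∑ n ∈ Finset.range (m + K + 1), 1 / (2 * (n : ℝ) + 1) := by
  rw [← Finset.sum_product', ← Finset.sum_fiberwise_of_maps_to (g := fun p : ℕ × ℕ => p.1 + p.2)
    (t := Finset.range (m + K + 1))]
  · refine Finset.sum_le_sum fun n _ => ?_
    rw [← sum_antidiagonal_ncb_div n]
    calc _ = ∑ p ∈ (Finset.range (m + 1) ×ˢ Finset.range (K + 1)).filter (fun p => p.1 + p.2 = n),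
          ncb p.1 * ncb p.2 / (2 * (n : ℝ) + 1) :=
        Finset.sum_congr rfl fun p hp => by rw [(Finset.mem_filter.1 hp).2]
      _ ≤ _ := Finset.sum_le_sum_of_subset_of_nonneg
        (fun p hp => Finset.HasAntidiagonal.mem_antidiagonal.2 (Finset.mem_filter.1 hp).2)
        fun p _ _ => by have := ncb_pos p.1; have := ncb_pos p.2; positivity
  · intro p hp
    simp only [Finset.mem_product, Finset.mem_range] at hp ⊢
    omega

/-- The square contains the complete antidiagonals k + j = n for n ≤ K. -/
theorem le_sum_product (K : ℕ) :
    ∑ n ∈ Finset.range (K + 1), 1 / (2 * (n : ℝ) + 1) ≤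
    ∑ k ∈ Finset.range (K + 1), ∑ j ∈ Finset.range (K + 1),
      ncb k * ncb j / (2 * ((k + j : ℕ) : ℝ) + 1) := by
  have hpos : ∀ p : ℕ × ℕ, 0 ≤ ncb p.1 * ncb p.2 / (2 * ((p.1 + p.2 : ℕ) : ℝ) + 1) := fun p => by
    have := ncb_pos p.1; have := ncb_pos p.2; positivity
  rw [← Finset.sum_product', ← Finset.sum_fiberwise_of_maps_to (g := fun p : ℕ × ℕ => p.1 + p.2)
    (t := Finset.range (K + K + 1))]
  · refine le_trans ?_ (Finset.sum_le_sum_of_subset_of_nonneg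
      (Finset.range_mono (by omega : K + 1 ≤ K + K + 1))
      fun n _ _ => Finset.sum_nonneg fun p _ => hpos p)
    refine Finset.sum_le_sum fun n hn => ?_
    rw [← sum_antidiagonal_ncb_div n]
    calc _ = ∑ p ∈ Finset.HasAntidiagonal.antidiagonal n, ncb p.1 * ncb p.2 / (2 * ((p.1 + p.2 : ℕ) : ℝ) + 1) :=
        Finset.sum_congr rfl fun p hp => by rw [Finset.HasAntidiagonal.mem_antidiagonal.1 hp]
      _ ≤ _ := by
        refine Finset.sum_le_sum_of_subset_of_nonneg (fun p hp => ?_) fun p _ _ => hpos p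
        simp only [Finset.mem_filter, Finset.mem_product, Finset.mem_range,
          Finset.HasAntidiagonal.mem_antidiagonal] at hp hn ⊢
        omega
  · intro p hp
    simp only [Finset.mem_product, Finset.mem_range] at hp ⊢
    omega

theorem half_log_le_sum (K : ℕ) :
    1 / 2 * Real.log (K + 1) ≤ ∑ n ∈ Finset.range (K + 1), 1 / (2 * (n : ℝ) + 1) := by
  -- This stronger bound telescopes, each step being log x ≤ x - 1 for a ratio of consecutive odd
  -- numbers.
  have h : 1 / 2 * Real.log (2 * (K + 1 : ℕ) + 1) ≤
      ∑ n ∈ Finset.range (K + 1), 1 / (2 * (n : ℝ) + 1) := by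
    induction K + 1 with
    | zero => simp
    | succ n ih =>
      rw [Finset.sum_range_succ]
      have h1 := Real.log_le_sub_one_of_pos (x := (2 * (n + 1 : ℕ) + 1) / (2 * (n : ℝ) + 1))
        (by positivity)
      rw [Real.log_div (by positivity) (by positivity)] at h1
      have h2 : (2 * ((n + 1 : ℕ) : ℝ) + 1) / (2 * (n : ℝ) + 1) - 1 = 2 * (1 / (2 * (n : ℝ) + 1)) := by
        push_cast; field_simp; ring
      linarith
  refine le_trans ?_ h
  gcongr
  push_cast
  linarith

theorem sum_le_half_log (K : ℕ) :
    ∑ n ∈ Finset.range (K + 1), 1 / (2 * (n : ℝ) + 1) ≤ 1 + 1 / 2 * Real.log (2 * K + 1) := by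
  induction K with
  | zero => simp
  | succ n ih =>
    rw [Finset.sum_range_succ]
    have h1 := Real.log_le_sub_one_of_pos (x := (2 * (n : ℝ) + 1) / (2 * (n + 1 : ℕ) + 1))
      (by positivity)
    rw [Real.log_div (by positivity) (by positivity)] at h1
    have h2 : (2 * (n : ℝ) + 1) / (2 * (n + 1 : ℕ) + 1) - 1 =
        -(2 * (1 / (2 * ((n + 1 : ℕ) : ℝ) + 1))) := by
      push_cast; field_simp; ring
    linarith

theorem two_sqrt_mul_one_div_sqrt {A B : ℝ} (hA : 0 ≤ A) (hB : 0 < B) :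
    2 * √(A / Real.pi) * (1 / √(Real.pi * B)) = 2 / Real.pi * √(A / B) := by
  have hp := Real.pi_pos
  rw [Real.sqrt_div hA, Real.sqrt_mul hp.le, Real.sqrt_div hA]
  have h : Real.pi = √Real.pi * √Real.pi := (Real.mul_self_sqrt hp.le).symm
  have h2 : 0 < √Real.pi := Real.sqrt_pos.2 hp
  have h3 : 0 < √B := Real.sqrt_pos.2 hB
  conv_rhs => rw [h]
  field_simp

/-! ### Two-sided bounds for the double sum -/

/-- All terms are nonnegative; keep those with k, j ≤ K and bound the slowly varying factors by
their Wallis values at the worst index. -/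
theorem le_rootSum {m M K : ℕ} (hK : K ≤ m) (hM : m ≤ M) :
    2 / Real.pi * √(((m - K : ℕ) + 1 / 2) / (M + 1 / 2)) *
      ∑ n ∈ Finset.range (K + 1), 1 / (2 * (n : ℝ) + 1) ≤ rootSum m M := by
  have hp := Real.pi_pos
  rw [← two_sqrt_mul_one_div_sqrt (by positivity) (by positivity)]
  have hpos : ∀ k j : ℕ, 0 ≤ ((2 * ((m - k : ℕ) : ℝ) + 1) * ncb (m - k) * ncb k) *
      (ncb (M - j) * ncb j) / (2 * ((k + j : ℕ) : ℝ) + 1) := fun k j => by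
    have := ncb_pos k; have := ncb_pos j; have := ncb_pos (m - k); have := ncb_pos (M - j)
    positivity
  calc _ ≤ 2 * √(((m - K : ℕ) + 1 / 2) / Real.pi) * (1 / √(Real.pi * (M + 1 / 2))) *
        ∑ k ∈ Finset.range (K + 1), ∑ j ∈ Finset.range (K + 1),
          ncb k * ncb j / (2 * ((k + j : ℕ) : ℝ) + 1) := by
        exact mul_le_mul_of_nonneg_left (le_sum_product K) (by positivity)
    _ ≤ ∑ k ∈ Finset.range (K + 1), ∑ j ∈ Finset.range (K + 1),
        ((2 * ((m - k : ℕ) : ℝ) + 1) * ncb (m - k) * ncb k) * (ncb (M - j) * ncb j) /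
          (2 * ((k + j : ℕ) : ℝ) + 1) := by
        rw [Finset.mul_sum]
        refine Finset.sum_le_sum fun k hk => ?_
        rw [Finset.mul_sum]
        refine Finset.sum_le_sum fun j hj => ?_
        rw [Finset.mem_range] at hk hj
        have u1 := ncb_pos k
        have u2 := ncb_pos j
        have u3 := ncb_pos (m - k)
        have h1 : 2 * √(((m - K : ℕ) + 1 / 2) / Real.pi) ≤
            (2 * ((m - k : ℕ) : ℝ) + 1) * ncb (m - k) := by
          refine le_trans ?_ (le_mul_ncb (m - k))
          gcongr
          omega
        have h2 : 1 / √(Real.pi * (M + 1 / 2)) ≤ ncb (M - j) := by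
          refine le_trans ?_ (one_div_le_ncb (M - j))
          gcongr
          omega
        calc _ = (2 * √(((m - K : ℕ) + 1 / 2) / Real.pi)) * (1 / √(Real.pi * (M + 1 / 2))) *
              (ncb k * ncb j / (2 * ((k + j : ℕ) : ℝ) + 1)) := rfl
          _ ≤ ((2 * ((m - k : ℕ) : ℝ) + 1) * ncb (m - k)) * ncb (M - j) *
              (ncb k * ncb j / (2 * ((k + j : ℕ) : ℝ) + 1)) := by gcongr
          _ = _ := by ring
    _ ≤ ∑ k ∈ Finset.range (K + 1), ∑ j ∈ Finset.range (M + 1),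
        ((2 * ((m - k : ℕ) : ℝ) + 1) * ncb (m - k) * ncb k) * (ncb (M - j) * ncb j) /
          (2 * ((k + j : ℕ) : ℝ) + 1) :=
        Finset.sum_le_sum fun k _ => Finset.sum_le_sum_of_subset_of_nonneg
          (Finset.range_mono (by omega)) fun j _ _ => hpos k j
    _ ≤ _ := Finset.sum_le_sum_of_subset_of_nonneg
          (Finset.range_mono (by omega)) fun k _ _ => Finset.sum_nonneg fun j _ => hpos k j

/-- Only j has to be cut, because (2(m-k)+1)u_{m-k} is bounded uniformly in k while u_{M-j} is not
small near j = M. For j > K the denominator exceeds 2(K+1), and the convolution identity together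
with ∑ u_k = (2m+1)u_m bounds what is left. -/
theorem rootSum_le {m M K : ℕ} (hM : K < M) :
    rootSum m M ≤ 2 / Real.pi * √((m + 1) / (M - K : ℕ)) *
      ∑ n ∈ Finset.range (m + K + 1), 1 / (2 * (n : ℝ) + 1) +
      2 * (m + 1) / (Real.pi * (K + 1)) := by
  have hp := Real.pi_pos
  have hMK : (0 : ℝ) < (M - K : ℕ) := by exact_mod_cast Nat.sub_pos_of_lt hM
  rw [← two_sqrt_mul_one_div_sqrt (by positivity) (by positivity)]
  have hA : ∀ k : ℕ, (2 * ((m - k : ℕ) : ℝ) + 1) * ncb (m - k) ≤ 2 * √((m + 1) / Real.pi) :=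
    fun k => by
      refine (mul_ncb_le (m - k)).trans ?_
      gcongr
      omega
  have hsum : ∑ j ∈ Finset.Ico (K + 1) (M + 1), ncb (M - j) * ncb j ≤ 1 := by
    rw [← sum_antidiagonal_ncb M, Finset.Nat.sum_antidiagonal_eq_sum_range_succ
      (fun i j => ncb i * ncb j) M]
    simp only [mul_comm (ncb (M - _))]
    refine Finset.sum_le_sum_of_subset_of_nonneg (fun j hj => ?_) fun j _ _ => ?_
    · rw [Finset.mem_Ico] at hj; rw [Finset.mem_range]; omega
    · have := ncb_pos j; have := ncb_pos (M - j); positivity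
  have h1 : ∑ k ∈ Finset.range (m + 1), ∑ j ∈ Finset.range (K + 1),
      ((2 * ((m - k : ℕ) : ℝ) + 1) * ncb (m - k) * ncb k) * (ncb (M - j) * ncb j) /
        (2 * ((k + j : ℕ) : ℝ) + 1) ≤
      2 * √((m + 1) / Real.pi) * (1 / √(Real.pi * (M - K : ℕ))) *
      ∑ n ∈ Finset.range (m + K + 1), 1 / (2 * (n : ℝ) + 1) := by
    refine le_trans ?_ (mul_le_mul_of_nonneg_left (sum_product_le m K) (by positivity))
    rw [Finset.mul_sum]
    refine Finset.sum_le_sum fun k hk => ?_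
    rw [Finset.mul_sum]
    refine Finset.sum_le_sum fun j hj => ?_
    rw [Finset.mem_range] at hk hj
    have u1 := ncb_pos k
    have u2 := ncb_pos j
    have u3 := ncb_pos (m - k)
    have u4 := ncb_pos (M - j)
    have h2 : ncb (M - j) ≤ 1 / √(Real.pi * (M - K : ℕ)) := by
      refine (ncb_le_one_div (by omega)).trans ?_
      gcongr
      omega
    calc _ = ((2 * ((m - k : ℕ) : ℝ) + 1) * ncb (m - k)) * ncb (M - j) *
          (ncb k * ncb j / (2 * ((k + j : ℕ) : ℝ) + 1)) := by ring
      _ ≤ _ := by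
        refine mul_le_mul_of_nonneg_right ?_ (by positivity)
        exact mul_le_mul (hA k) h2 u4.le (by positivity)
  have h2 : ∑ k ∈ Finset.range (m + 1), ∑ j ∈ Finset.Ico (K + 1) (M + 1),
      ((2 * ((m - k : ℕ) : ℝ) + 1) * ncb (m - k) * ncb k) * (ncb (M - j) * ncb j) /
        (2 * ((k + j : ℕ) : ℝ) + 1) ≤ 2 * (m + 1) / (Real.pi * (K + 1)) := by
    calc _ ≤ ∑ k ∈ Finset.range (m + 1), ∑ j ∈ Finset.Ico (K + 1) (M + 1),
          (2 * √((m + 1) / Real.pi) / (2 * (K + 1))) * (ncb k * (ncb (M - j) * ncb j)) := by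
          refine Finset.sum_le_sum fun k hk => Finset.sum_le_sum fun j hj => ?_
          rw [Finset.mem_Ico] at hj
          have u1 := ncb_pos k
          have u2 := ncb_pos j
          have u3 := ncb_pos (m - k)
          have u4 := ncb_pos (M - j)
          have hj' : (K : ℝ) + 1 ≤ j := by exact_mod_cast hj.1
          have hk' : (0 : ℝ) ≤ k := by positivity
          calc _ = ((2 * ((m - k : ℕ) : ℝ) + 1) * ncb (m - k)) / (2 * ((k + j : ℕ) : ℝ) + 1) *
                (ncb k * (ncb (M - j) * ncb j)) := by ring
            _ ≤ _ := by
              refine mul_le_mul_of_nonneg_right ?_ (by positivity)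
              exact div_le_div₀ (by positivity) (hA k) (by positivity) (by push_cast; linarith)
      _ = (2 * √((m + 1) / Real.pi) / (2 * (K + 1))) * ((2 * m + 1) * ncb m) *
          ∑ j ∈ Finset.Ico (K + 1) (M + 1), ncb (M - j) * ncb j := by
          rw [← sum_range_ncb, mul_assoc, Finset.sum_mul_sum, Finset.mul_sum]
          exact Finset.sum_congr rfl fun k _ => by rw [Finset.mul_sum]
      _ ≤ (2 * √((m + 1) / Real.pi) / (2 * (K + 1))) * (2 * √((m + 1) / Real.pi)) * 1 := by
          have := ncb_pos m
          refine mul_le_mul ?_ hsum (Finset.sum_nonneg fun j _ =>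
            (mul_pos (ncb_pos _) (ncb_pos _)).le) (by positivity)
          exact mul_le_mul_of_nonneg_left (mul_ncb_le m) (by positivity)
      _ = 2 * (√((m + 1) / Real.pi) * √((m + 1) / Real.pi)) / (K + 1) := by field_simp
      _ = _ := by
          rw [Real.mul_self_sqrt (by positivity)]
          field_simp
  refine le_trans (le_of_eq ?_) (add_le_add h1 h2)
  rw [← Finset.sum_add_distrib, rootSum]
  refine Finset.sum_congr rfl fun k _ => ?_
  rw [Finset.sum_range_add_sum_Ico _ (by omega)]

theorem rootSum_half_bounds {n : ℕ} {s : ℝ} (hs : 2 < s) (hn : 1 ≤ n) (hsn : s ≤ n) :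
    2 / Real.pi * √((1 / 2 - 1 / s) / (1 / 2 + 1 / n)) * (1 / 2 * (Real.log n - Real.log s)) ≤
      rootSum (n / 2) ((n + 1) / 2) ∧
    rootSum (n / 2) ((n + 1) / 2) ≤
      2 / Real.pi * √((1 / 2 + 1 / n) / (1 / 2 - 1 / s)) *
        (1 + 1 / 2 * (Real.log 3 + Real.log n)) + 2 * (1 / 2 + 1 / n) * s / Real.pi := by
  have hp := Real.pi_pos
  have hx : (0 : ℝ) < n := by exact_mod_cast hn
  have hx1 : (1 : ℝ) ≤ n := by exact_mod_cast hn
  have hs0 : 0 < s := by linarith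
  -- As s > 2, this cut stays below n/2; log K costs log s, and the tail bound is of order n/K, that
  -- is of order s.
  set K := ⌊(n : ℝ) / s⌋₊ with hKdef
  have hK1 : (K : ℝ) ≤ n / s := Nat.floor_le (by positivity)
  have hK2 : (n : ℝ) / s < K + 1 := Nat.lt_floor_add_one _
  have hlt : (n : ℝ) / s < n / 2 := by gcongr
  have h2K : 2 * K < n := by
    have : (2 * K : ℝ) < n := by linarith
    exact_mod_cast this
  have hm : ((n / 2 : ℕ) : ℝ) ≤ n / 2 := Nat.cast_div_le
  have hm' : (n : ℝ) ≤ 2 * (n / 2 : ℕ) + 1 := by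
    have : n ≤ 2 * (n / 2) + 1 := by omega
    exact_mod_cast this
  have hM : (2 : ℝ) * ((n + 1) / 2 : ℕ) ≤ n + 1 := by
    have : 2 * ((n + 1) / 2) ≤ n + 1 := by omega
    exact_mod_cast this
  have hM' : (n : ℝ) ≤ 2 * ((n + 1) / 2 : ℕ) := by
    have : n ≤ 2 * ((n + 1) / 2) := by omega
    exact_mod_cast this
  have hδ : 0 < 1 / 2 - 1 / s := by
    have := one_div_lt_one_div_of_lt two_pos hs
    linarith
  have e1 : (n : ℝ) * (1 / 2 - 1 / s) = n / 2 - n / s := by ring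
  have e2 : (n : ℝ) * (1 / 2 + 1 / n) = n / 2 + 1 := by field_simp
  have hKm : K ≤ n / 2 := by omega
  have hKM : K < (n + 1) / 2 := by omega
  constructor
  · refine le_trans ?_ (le_rootSum hKm (by omega : n / 2 ≤ (n + 1) / 2))
    have hlog : 1 / 2 * (Real.log n - Real.log s) ≤
        ∑ j ∈ Finset.range (K + 1), 1 / (2 * (j : ℝ) + 1) := by
      refine le_trans ?_ (half_log_le_sum K)
      rw [← Real.log_div hx.ne' hs0.ne']
      gcongr
    have hlog0 : 0 ≤ Real.log n - Real.log s := sub_nonneg.2 (Real.log_le_log hs0 hsn)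
    rw [← mul_div_mul_left (1 / 2 - 1 / s) (1 / 2 + 1 / (n : ℝ)) hx.ne', e1, e2]
    have hfrac : ((n : ℝ) / 2 - n / s) / (n / 2 + 1) ≤
        ((n / 2 - K : ℕ) + 1 / 2) / (((n + 1) / 2 : ℕ) + 1 / 2) :=
      div_le_div₀ (by positivity) (by rw [Nat.cast_sub hKm]; linarith) (by positivity) (by linarith)
    exact mul_le_mul (mul_le_mul_of_nonneg_left (Real.sqrt_le_sqrt hfrac) (by positivity)) hlog
      (by positivity) (by positivity)
  · refine (rootSum_le (m := n / 2) hKM).trans ?_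
    have hlog : ∑ j ∈ Finset.range (n / 2 + K + 1), 1 / (2 * (j : ℝ) + 1) ≤
        1 + 1 / 2 * (Real.log 3 + Real.log n) := by
      refine (sum_le_half_log _).trans ?_
      rw [← Real.log_mul (by norm_num) hx.ne']
      have h : ((n / 2 + K : ℕ) : ℝ) ≤ n := by exact_mod_cast (by omega : n / 2 + K ≤ n)
      gcongr
      linarith
    have hpos : 0 < (n : ℝ) / 2 - n / s := by linarith
    rw [← mul_div_mul_left (1 / 2 + 1 / (n : ℝ)) (1 / 2 - 1 / s) hx.ne', e1, e2]
    refine add_le_add ?_ ?_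
    · gcongr
      rw [Nat.cast_sub hKM.le]; linarith
    · have e3 : 2 * (1 / 2 + 1 / (n : ℝ)) * s / Real.pi = 2 * (n / 2 + 1) / (Real.pi * (n / s)) := by
        field_simp
      rw [e3]
      gcongr

/-! ### Asymptotics -/

/-- Take s = √(log n): it tends to infinity, so the square roots tend to 1, while both s and log s
are o(log n). -/
theorem tendsto_expectedRealRoots_succ_div_log (hconj : AbsoluteConjecture) :
    Tendsto (fun n : ℕ => expectedRealRoots (n + 1) / Real.log n) atTop (nhds (1 / Real.pi)) := by
  have hL : Tendsto (fun n : ℕ => Real.log n) atTop atTop :=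
    Real.tendsto_log_atTop.comp tendsto_natCast_atTop_atTop
  have hs : Tendsto (fun n : ℕ => √(Real.log n)) atTop atTop := Real.tendsto_sqrt_atTop.comp hL
  have hs' : Tendsto (fun n : ℕ => 1 / √(Real.log n)) atTop (nhds 0) :=
    tendsto_const_nhds.div_atTop hs
  have hL' : Tendsto (fun n : ℕ => 1 / Real.log n) atTop (nhds 0) :=
    tendsto_const_nhds.div_atTop hL
  have hn' : Tendsto (fun n : ℕ => 1 / (n : ℝ)) atTop (nhds 0) :=
    tendsto_const_nhds.div_atTop tendsto_natCast_atTop_atTop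
  have hll : Tendsto (fun n : ℕ => Real.log (√(Real.log n)) / Real.log n) atTop (nhds 0) := by
    have h : Tendsto (fun x : ℝ => Real.log x / x) atTop (nhds 0) := by
      simpa using Real.isLittleO_log_id_atTop.tendsto_div_nhds_zero
    have h2 := (h.comp hL).const_mul (1 / 2)
    rw [mul_zero] at h2
    refine h2.congr' ?_
    filter_upwards [hL.eventually_ge_atTop 0] with n hn
    rw [Function.comp_apply, Real.log_sqrt hn]
    ring
  have ha : Tendsto (fun n : ℕ => (1 / 2 - 1 / √(Real.log n))) atTop (nhds (1 / 2)) := by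
    simpa only [sub_zero] using hs'.const_sub (1 / 2)
  have hb : Tendsto (fun n : ℕ => (1 / 2 + 1 / (n : ℝ))) atTop (nhds (1 / 2)) := by
    simpa only [add_zero] using hn'.const_add (1 / 2)
  have hlow : Tendsto (fun n : ℕ => 2 / Real.pi *
      √((1 / 2 - 1 / √(Real.log n)) / (1 / 2 + 1 / n)) *
      (1 / 2 * (1 - Real.log (√(Real.log n)) / Real.log n))) atTop (nhds (1 / Real.pi)) := by
    have := (((ha.div hb (by norm_num)).sqrt).const_mul (2 / Real.pi)).mul
      ((hll.const_sub 1).const_mul (1 / 2))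
    convert! this using 2
    norm_num
  have hup : Tendsto (fun n : ℕ => 2 / Real.pi *
      √((1 / 2 + 1 / n) / (1 / 2 - 1 / √(Real.log n))) *
      ((1 + 1 / 2 * Real.log 3) * (1 / Real.log n) + 1 / 2) +
      2 * (1 / 2 + 1 / n) * (1 / √(Real.log n)) / Real.pi) atTop (nhds (1 / Real.pi)) := by
    have := ((((hb.div ha (by norm_num)).sqrt).const_mul (2 / Real.pi)).mul
      ((hL'.const_mul (1 + 1 / 2 * Real.log 3)).add_const (1 / 2))).add
      (((hb.const_mul 2).mul hs').div_const Real.pi)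
    convert! this using 2
    norm_num
  have hev : ∀ᶠ n : ℕ in atTop, 2 < √(Real.log n) ∧ 1 ≤ n ∧ √(Real.log n) ≤ n := by
    filter_upwards [hs.eventually_gt_atTop 2, eventually_ge_atTop 1] with n h1 h2
    refine ⟨h1, h2, ?_⟩
    have hx : (1 : ℝ) ≤ n := by exact_mod_cast h2
    rw [Real.sqrt_le_left (by positivity)]
    have := Real.log_le_sub_one_of_pos (x := (n : ℝ)) (by positivity)
    nlinarith
  refine tendsto_of_tendsto_of_tendsto_of_le_of_le' hlow hup ?_ ?_
  · filter_upwards [hev] with n ⟨h1, h2, h3⟩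
    have hlog : 0 < Real.log n := Real.sqrt_pos.1 (by linarith)
    rw [expectedRealRoots_succ_eq_rootSum hconj, le_div_iff₀ hlog]
    refine le_trans (le_of_eq ?_) (rootSum_half_bounds h1 h2 h3).1
    field_simp
  · filter_upwards [hev] with n ⟨h1, h2, h3⟩
    have hlog : 0 < Real.log n := Real.sqrt_pos.1 (by linarith)
    rw [expectedRealRoots_succ_eq_rootSum hconj, div_le_iff₀ hlog]
    refine (rootSum_half_bounds h1 h2 h3).2.trans (le_of_eq ?_)
    have hsq : √(Real.log n) * √(Real.log n) = Real.log n := Real.mul_self_sqrt hlog.le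
    have hdiv : 1 / √(Real.log n) * Real.log n = √(Real.log n) := by
      rw [div_mul_eq_mul_div, one_mul, Real.div_sqrt]
    have hone : 1 / Real.log n * Real.log n = 1 := by field_simp
    linear_combination (-(2 * (1 / 2 + 1 / (n : ℝ)) / Real.pi)) * hdiv -
      (2 / Real.pi * √((1 / 2 + 1 / (n : ℝ)) / (1 / 2 - 1 / √(Real.log n))) *
        (1 + 1 / 2 * Real.log 3)) * hone

end RandomPoly

theorem mainTheorem9 (hconj : RandomPoly.AbsoluteConjecture) :
    (fun N : ℕ => RandomPoly.expectedRealRoots N) ~[atTop]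
      (fun N : ℕ => 1 / Real.pi * Real.log (N : ℝ)) := by
  have hp := Real.pi_pos
  have hL : Tendsto (fun n : ℕ => Real.log n) atTop atTop :=
    Real.tendsto_log_atTop.comp tendsto_natCast_atTop_atTop
  have hL1 : Tendsto (fun n : ℕ => Real.log (n + 1 : ℕ)) atTop atTop :=
    hL.comp (tendsto_add_atTop_nat 1)
  have hratio : Tendsto (fun n : ℕ => Real.log n / Real.log (n + 1 : ℕ)) atTop (nhds 1) := by
    -- The lower bound uses n + 1 ≤ 2n. The ratio is needed because the limit above compares r_{n+1}
    -- with log n rather than log(n + 1).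
    have h : Tendsto (fun n : ℕ => 1 - Real.log 2 / Real.log (n + 1 : ℕ)) atTop (nhds 1) := by
      simpa using (tendsto_const_nhds (x := Real.log 2)).div_atTop hL1 |>.const_sub 1
    refine tendsto_of_tendsto_of_tendsto_of_le_of_le' h tendsto_const_nhds ?_ ?_
    · filter_upwards [eventually_ge_atTop 1, hL1.eventually_gt_atTop 0] with n hn hlog
      have hx : (1 : ℝ) ≤ n := by exact_mod_cast hn
      rw [one_sub_div hlog.ne']
      gcongr
      rw [sub_le_iff_le_add, ← Real.log_mul (by positivity) (by norm_num)]
      push_cast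
      gcongr
      linarith
    · filter_upwards [eventually_ge_atTop 1, hL1.eventually_gt_atTop 0] with n hn hlog
      have hx : (1 : ℝ) ≤ n := by exact_mod_cast hn
      rw [div_le_one hlog]
      push_cast
      gcongr
      linarith
  have hmain := ((RandomPoly.tendsto_expectedRealRoots_succ_div_log hconj).mul hratio).const_mul
    Real.pi
  rw [mul_one, mul_one_div_cancel hp.ne'] at hmain
  refine isEquivalent_of_tendsto_one ?_
  rw [← tendsto_add_atTop_iff_nat 1]
  refine hmain.congr' ?_
  filter_upwards [hL.eventually_gt_atTop 0] with n hlog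
  simp only [Pi.div_apply]
  field_simp
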